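/- **Setting.** Let $\mathbb D=\mathbb D([0,1],\mathbb R)$ be the space of real càdlàg functions on $[0,1]$ with the Skorohod $J_1$ metric $d_{J_1}(f,g)=\inf_{\tau}\max\{\sup_t|f(t)-g(\tau(t))|,\ \sup_t|\tau(t)-t|\}$, the infimum being over all strictly increasing continuous $\tau:[0,1]\to[0,1]$ with $\tau(0)=0$, $\tau(1)=1$, and with its Borel $\sigma$-field. For $j\ge 0$ let $U_j^\uparrow=\{\boldsymbol u\in[0,1]^j: u_1<\dots<u_j\}$ and $$h_j:(\mathbb R\setminus\{0\})^j\times U_j^\uparrow\to\mathbb D,\qquad h_j(\boldsymbol z,\boldsymbol u)(t)=\sum_{i=1}^j z_i\mathbf 1\{u_i\le t\}.$$ Let $\mathbb D_{=j}$ be the image of $h_j$ (so $\mathbb D_{=0}=\{0\}$) and $\mathbb D_{\le j}=\bigcup_{i=0}^j\mathbb D_{=i}$. For a metric space $\mathbb S$ and closed $\mathbb C\subset\mathbb S$, a set $A$ is bounded away from $\mathbb C$ if $\inf\{d(x,y):x\in\mathbb C,\,y\in A\}>0$; $\mathbb M(\mathbb S\setminus\mathbb C)$ is the set of Borel measures on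 $\mathbb S\setminus\mathbb C$ that are finite on Borel sets bounded away from $\mathbb C$; and $\mu_n\to\mu$ in $\mathbb M(\mathbb S\setminus\mathbb C)$ means that $\mu_n,\mu\in\mathbb M(\mathbb S\setminus\mathbb C)$, $\limsup_n\mu_n(F)\le\mu(F)$ for every closed $F$ and $\liminf_n\mu_n(G)\ge\mu(G)$ for every open $G$, both bounded away from $\mathbb C$. A sequence $(a_n)_{n\ge1}$ of positive numbers is in $RV_\beta$ if $a_{\lfloor cn\rfloor}/a_n\to c^\beta$ for all $c>0$. A real random variable $X$ is in $RV_{-\alpha}$ if there are a regularly varying sequence $(\gamma_n)$ and a non-zero $\mu\in\mathbb M(\mathbb R\setminus\{0\})$ with $\gamma_nP(X/n\in\cdot)\to\mu$ in $\mathbb M(\mathbb R\setminus\{0\})$ and $\mu(sA)=s^{-\alpha}\mu(A)$ for all $s>0$ and Borel $A\subset\mathbb R\setminus\{0\}$. **Theorem 3.5.** Let $Z_1,Z_2,\dots$ be iid real random variables with $Z_1\in RV_{-\alpha}$, $\alpha>0$, satisfying the tail balance condition $$\frac{P(Z_1>n)}{P(|Z_1|>n)}\to p,\qquad \frac{P(Z_1<-n)}{P(|Z_1|>n)}\to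 q=1-p$$ for some $p\in[0,1]$, and with $E Z_1=0$ if $E|Z_1|<\infty$. Let $(\lambda_n)\in RV_\rho$ be a sequence with $\lambda_n\to\infty$, where $\rho>1/2$ if $\operatorname{Var}(Z_1)<\infty$, and $\alpha\rho>1$ if $\operatorname{Var}(Z_1)=\infty$. Put $\boldsymbol X^{(n)}(t)=\sum_{k=1}^{n}Z_k\mathbf 1\{k/n\le t\}$ for $t\in[0,1]$, and let $\nu_\alpha$ be the measure on $\mathbb R\setminus\{0\}$ with $\nu_\alpha((-\infty,-y)\cup(x,\infty))=qy^{-\alpha}+px^{-\alpha}$ for $x,y>0$. Then for every $j\ge1$, as $n\to\infty$, $$[nP(|Z_1|>\lambda_n)]^{-j}\,P\bigl(\boldsymbol X^{(n)}/\lambda_n\in\cdot\bigr)\ \to\ (\nu_\alpha^j\times\mathrm{Leb}_j)\circ h_j^{-1}\quad\text{in }\mathbb M(\mathbb D\setminus\mathbb D_{\le j-1}),$$ where $\nu_\alpha^j$ is the $j$-fold product of $\nu_\alpha$ and $\mathrm{Leb}_j$ is Lebesgue measure on $U_j^\uparrow$. -/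

import Mathlib

open MeasureTheory ProbabilityTheory Filter Topology
open scoped ENNReal

noncomputable section

/-! ### The Skorohod space `D([0,1], ℝ)` -/

/-- Real-valued càdlàg functions on `[0,1]`: right-continuous with left limits. -/
@[ext]
structure SkorohodD where
  toFun : unitInterval → ℝ
  right_cts : ∀ t, ContinuousWithinAt toFun (Set.Ici t) t
  left_lim : ∀ t, ∃ l : ℝ, Tendsto toFun (𝓝[<] t) (𝓝 l)

namespace SkorohodD

instance : CoeFun SkorohodD (fun _ => unitInterval → ℝ) := ⟨SkorohodD.toFun⟩

/-- `‖f - g ∘ τ‖ ∨ ‖τ - e‖` (sup norms over `[0,1]`). The order automorphisms `τ` of `[0,1]` are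
exactly the strictly increasing continuous maps `[0,1] → [0,1]` with `τ 0 = 0` and `τ 1 = 1`. -/
def j1Cost (f g : SkorohodD) (τ : unitInterval ≃o unitInterval) : ℝ≥0∞ :=
  max (⨆ t : unitInterval, edist (f t) (g (τ t))) (⨆ t : unitInterval, edist (τ t) t)

/-- The Skorohod `J₁` metric `d(f,g) = inf_τ ‖f - g ∘ τ‖ ∨ ‖τ - e‖`, as an extended distance (it is
finite, since càdlàg functions on `[0,1]` are bounded). -/
instance : PseudoEMetricSpace SkorohodD where
  edist f g := ⨅ τ : unitInterval ≃o unitInterval, j1Cost f g τ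
  edist_self f := by
    refine le_antisymm (iInf_le_of_le (OrderIso.refl unitInterval) ?_) bot_le
    simp [j1Cost]
  edist_comm := by
    have key : ∀ f g : SkorohodD, (⨅ τ : unitInterval ≃o unitInterval, j1Cost f g τ) ≤
        ⨅ τ : unitInterval ≃o unitInterval, j1Cost g f τ := by
      intro f g
      refine le_iInf fun τ => iInf_le_of_le τ.symm (max_le_max ?_ ?_)
      · refine iSup_le fun t => ?_
        refine le_trans (le_of_eq ?_) (le_iSup _ (τ.symm t))
        simp [edist_comm]
      · refine iSup_le fun t => ?_
        refine le_trans (le_of_eq ?_) (le_iSup _ (τ.symm t))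
        simp [edist_comm]
    exact fun f g => le_antisymm (key f g) (key g f)
  edist_triangle f g h := by
    refine ENNReal.le_iInf_add_iInf fun τ τ' => iInf_le_of_le (τ.trans τ') (max_le ?_ ?_)
    · refine iSup_le fun t => (edist_triangle _ (g (τ t)) _).trans (add_le_add ?_ ?_)
      · exact (le_iSup (fun t : unitInterval => edist (f t) (g (τ t))) t).trans (le_max_left _ _)
      · exact (le_iSup (fun t : unitInterval => edist (g t) (h (τ' t))) (τ t)).trans (le_max_left _ _)
    · refine iSup_le fun t => (edist_triangle _ (τ t) _).trans ?_
      rw [add_comm]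
      refine add_le_add ?_ ?_
      · exact (le_iSup (fun t : unitInterval => edist (τ t) t) t).trans (le_max_right _ _)
      · exact (le_iSup (fun t : unitInterval => edist (τ' t) t) (τ t)).trans (le_max_right _ _)

instance : MeasurableSpace SkorohodD := borel SkorohodD

instance : BorelSpace SkorohodD := ⟨rfl⟩

/-- Pointwise multiplication by a real number. -/
instance : SMul ℝ SkorohodD where
  smul c f :=
    { toFun := fun t => c * f t
      right_cts := fun t => (f.right_cts t).const_mul c
      left_lim := fun t => by
        obtain ⟨l, hl⟩ := f.left_lim t
        exact ⟨c * l, hl.const_mul c⟩ }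

end SkorohodD

/-- The step function `t ↦ ∑ i, z i * 1{u i ≤ t}`, with jump sizes `z` and jump times `u`. On the set
`jumpDomain j` this is the map `h_j`. -/
def stepFun {j : ℕ} (z u : Fin j → ℝ) : SkorohodD where
  toFun t := ∑ i, if u i ≤ (t : ℝ) then z i else 0
  right_cts t := by
    refine tendsto_finsetSum _ fun i _ => ?_
    by_cases h : u i ≤ (t : ℝ)
    · refine tendsto_const_nhds.congr' ?_
      filter_upwards [self_mem_nhdsWithin] with s hs
      have hts : (t : ℝ) ≤ s := hs
      rw [if_pos h, if_pos (h.trans hts)]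
    · refine tendsto_const_nhds.congr' ?_
      have hopen : IsOpen {s : unitInterval | (s : ℝ) < u i} :=
        isOpen_lt continuous_subtype_val continuous_const
      filter_upwards [mem_nhdsWithin_of_mem_nhds (hopen.mem_nhds (not_le.mp h))] with s hs
      rw [if_neg h, if_neg (not_le.mpr hs)]
  left_lim t := by
    refine ⟨∑ i, if u i < (t : ℝ) then z i else 0, tendsto_finsetSum _ fun i _ => ?_⟩
    by_cases h : u i < (t : ℝ)
    · refine tendsto_const_nhds.congr' ?_
      have hopen : IsOpen {s : unitInterval | u i < (s : ℝ)} :=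
        isOpen_lt continuous_const continuous_subtype_val
      filter_upwards [mem_nhdsWithin_of_mem_nhds (hopen.mem_nhds h)] with s hs
      rw [if_pos h, if_pos (le_of_lt hs)]
    · refine tendsto_const_nhds.congr' ?_
      filter_upwards [self_mem_nhdsWithin] with s hs
      have hst : (s : ℝ) < t := hs
      rw [if_neg h, if_neg (not_le.mpr (hst.trans_le (not_lt.mp h)))]

/-- `(ℝ \ {0})^j × U_j^↑`, where `U_j^↑ = {u ∈ [0,1]^j : u_1 < ⋯ < u_j}`. -/
def jumpDomain (j : ℕ) : Set ((Fin j → ℝ) × (Fin j → ℝ)) :=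
  {zu | (∀ i, zu.1 i ≠ 0) ∧ (∀ i, zu.2 i ∈ Set.Icc (0 : ℝ) 1) ∧ StrictMono zu.2}

/-- Step functions with exactly `j` jumps: the image of `jumpDomain j` under `h_j`. A non-zero value
at time `0` counts as a jump; for `j = 0` only the zero function remains. -/
def stepExactly (j : ℕ) : Set SkorohodD :=
  (fun zu => stepFun zu.1 zu.2) '' jumpDomain j

/-- Step functions with at most `j` jumps. -/
def stepAtMost (j : ℕ) : Set SkorohodD :=
  ⋃ i ∈ Finset.range (j + 1), stepExactly i

/-! ### Convergence in `M(S \ C)` -/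

/-- `μ` is finite on the Borel sets that are bounded away from `C`. -/
def FiniteAwayFrom {S : Type*} [PseudoEMetricSpace S] [MeasurableSpace S]
    (C : Set S) (μ : Measure S) : Prop :=
  ∀ A : Set S, MeasurableSet A → Metric.AreSeparated C A → μ A < ∞

/-- `μ n → μ₀` in `M(S \ C)`. Measures on `S \ C` are given here by measures on `S`, of which only the
values on sets bounded away from `C` matter. -/
structure TendstoMO {S : Type*} [PseudoEMetricSpace S] [MeasurableSpace S]
    (C : Set S) (μ : ℕ → Measure S) (μ₀ : Measure S) : Prop where
  finite : ∀ n, FiniteAwayFrom C (μ n)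
  finite_limit : FiniteAwayFrom C μ₀
  limsup_le : ∀ F : Set S, IsClosed F → Metric.AreSeparated C F →
    limsup (fun n => μ n F) atTop ≤ μ₀ F
  le_liminf : ∀ G : Set S, IsOpen G → Metric.AreSeparated C G →
    μ₀ G ≤ liminf (fun n => μ n G) atTop

/-! ### Regular variation -/

/-- The sequence `(a n)_{n ≥ 1}` of positive numbers is regularly varying with index `β`:
`a ⌊c n⌋ / a n → c ^ β` for every `c > 0`. -/
def RegVarSeq (a : ℕ → ℝ) (β : ℝ) : Prop :=
  (∀ n, 1 ≤ n → 0 < a n) ∧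
    ∀ c : ℝ, 0 < c → Tendsto (fun n : ℕ => a ⌊c * n⌋₊ / a n) atTop (𝓝 (c ^ β))

/-- The random variable `X` is regularly varying at infinity with index `-α`: for some regularly
varying sequence `γ` and some non-zero `μ` in `M(ℝ \ {0})`, `γ n * P(X / n ∈ ·) → μ` in
`M(ℝ \ {0})`, and `μ (s A) = s ^ (-α) * μ A` for `s > 0` and Borel `A ⊆ ℝ \ {0}`. -/
def RegVarRV {Ω : Type*} [MeasurableSpace Ω] (P : Measure Ω) (X : Ω → ℝ) (α : ℝ) : Prop :=
  ∃ (γ : ℕ → ℝ) (β : ℝ) (μ : Measure ℝ), RegVarSeq γ β ∧ μ {0}ᶜ ≠ 0 ∧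
    TendstoMO {0} (fun n => ENNReal.ofReal (γ n) • P.map (fun ω => X ω / n)) μ ∧
    ∀ s : ℝ, 0 < s → ∀ A : Set ℝ, MeasurableSet A → A ⊆ {0}ᶜ →
      μ ((fun x => s * x) '' A) = ENNReal.ofReal (s ^ (-α)) * μ A

/-- The tail balance condition with right-tail weight `p` and left-tail weight `1 - p`. -/
def TailBalance {Ω : Type*} [MeasurableSpace Ω] (P : Measure Ω) (X : Ω → ℝ) (p : ℝ) : Prop :=
  0 ≤ p ∧ p ≤ 1 ∧
    Tendsto (fun n : ℕ => P.real {ω | (n : ℝ) < X ω} / P.real {ω | (n : ℝ) < |X ω|})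
      atTop (𝓝 p) ∧
    Tendsto (fun n : ℕ => P.real {ω | X ω < -(n : ℝ)} / P.real {ω | (n : ℝ) < |X ω|})
      atTop (𝓝 (1 - p))

/-- The Lebesgue density of `nuAlpha α p`. -/
def nuDensity (α p : ℝ) (x : ℝ) : ℝ≥0∞ :=
  ENNReal.ofReal (if 0 < x then p * (α * x ^ (-α - 1))
    else if x < 0 then (1 - p) * (α * (-x) ^ (-α - 1)) else 0)

/-- The measure `ν_α` on `ℝ \ {0}`, seen as a measure on `ℝ` without mass at `0`; `nuAlpha_tails`
shows that `ν_α ((-∞,-y) ∪ (x,∞)) = (1 - p) y^(-α) + p x^(-α)` for `x, y > 0`. -/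
def nuAlpha (α p : ℝ) : Measure ℝ := volume.withDensity (nuDensity α p)

lemma lintegral_pareto_tail {α c x : ℝ} (hα : 0 < α) (hc : 0 ≤ c) (hx : 0 < x) :
    ∫⁻ t in Set.Ioi x, ENNReal.ofReal (c * (α * t ^ (-α - 1))) =
      ENNReal.ofReal (c * x ^ (-α)) := by
  have hlt : -α - 1 < -1 := by linarith
  have hint : IntegrableOn (fun t : ℝ => c * (α * t ^ (-α - 1))) (Set.Ioi x) :=
    ((integrableOn_Ioi_rpow_of_lt hlt hx).const_mul α).const_mul c
  rw [← ofReal_integral_eq_lintegral_ofReal hint]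
  · rw [integral_const_mul, integral_const_mul, integral_Ioi_rpow_of_lt hlt hx]
    have h1 : -α - 1 + 1 = -α := by ring
    rw [h1]
    congr 1
    field_simp
  · filter_upwards [ae_restrict_mem measurableSet_Ioi] with t ht
    have ht0 : (0 : ℝ) < t := hx.trans ht
    simp only [Pi.zero_apply]
    positivity

lemma nuAlpha_tails {α p x y : ℝ} (hα : 0 < α) (hp0 : 0 ≤ p) (hp1 : p ≤ 1)
    (hx : 0 < x) (hy : 0 < y) :
    nuAlpha α p (Set.Iio (-y) ∪ Set.Ioi x) =
      ENNReal.ofReal ((1 - p) * y ^ (-α) + p * x ^ (-α)) := by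
  have hdisj : Disjoint (Set.Iio (-y)) (Set.Ioi x) :=
    Set.disjoint_left.mpr fun t (h1 : t < -y) (h2 : x < t) => by linarith
  have hR : nuAlpha α p (Set.Ioi x) = ENNReal.ofReal (p * x ^ (-α)) := by
    rw [nuAlpha, withDensity_apply _ measurableSet_Ioi, ← lintegral_pareto_tail hα hp0 hx]
    refine setLIntegral_congr_fun measurableSet_Ioi fun t ht => ?_
    have ht0 : (0 : ℝ) < t := hx.trans ht
    simp [nuDensity, ht0]
  have hL : nuAlpha α p (Set.Iio (-y)) = ENNReal.ofReal ((1 - p) * y ^ (-α)) := by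
    rw [nuAlpha, withDensity_apply _ measurableSet_Iio,
      ← lintegral_pareto_tail hα (sub_nonneg.mpr hp1) hy]
    rw [← (Measure.measurePreserving_neg (volume : Measure ℝ)).setLIntegral_comp_preimage_emb
      (MeasurableEquiv.neg ℝ).measurableEmbedding]
    have hpre : (Neg.neg : ℝ → ℝ) ⁻¹' (Set.Iio (-y)) = Set.Ioi y := by
      ext t; simp
    rw [hpre]
    refine setLIntegral_congr_fun measurableSet_Ioi fun t ht => ?_
    have ht0 : 0 < t := hy.trans ht
    simp [nuDensity, ht0, not_lt.mpr ht0.le]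
  have h1p : 0 ≤ 1 - p := sub_nonneg.mpr hp1
  rw [measure_union hdisj measurableSet_Ioi, hL, hR, ← ENNReal.ofReal_add] <;> positivity

/-! ### The random walk and the limit measure -/

/-- The random walk embedded in `D`: `X^(n)(t) = ∑_{k=1}^n Z_k 1{k/n ≤ t}`. The increments are
numbered from `0`, so `Z k` is `Z_{k+1}`. -/
def walkPath {Ω : Type*} (Z : ℕ → Ω → ℝ) (n : ℕ) (ω : Ω) : SkorohodD :=
  stepFun (fun k : Fin n => Z k ω) (fun k : Fin n => ((k : ℝ) + 1) / n)

/-- `(ν_α^j × Leb_j) ∘ h_j⁻¹`. -/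
def limitMeasure (α p : ℝ) (j : ℕ) : Measure SkorohodD :=
  (((Measure.pi fun _ : Fin j => nuAlpha α p).prod
    (volume : Measure (Fin j → ℝ))).restrict (jumpDomain j)).map
      (fun zu => stepFun zu.1 zu.2)

end

/-!
Since `n P(|Z₁| > λ_n) → 0`, having `j + 1` increments larger than `δ λ_n` costs a further factor
`n P(|Z₁| > λ_n)` and is negligible after division by `[n P(|Z₁| > λ_n)]^j`. The increments of size
at most `δ λ_n` have partial sums that stay below `ε λ_n` except with probability
`o([n P(|Z₁| > λ_n)]^j)`, provided `δ` is small compared with `ε`: Chernoff's bound decays like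
any prescribed power of `n`. Hence `X^(n) / λ_n` is `ε`-close to the step function of its large
jumps. A path at distance `> c` from the step functions with at most `j - 1` jumps must have `j`
jumps larger than `c`, so exactly `j` large jumps remain. Given their positions, the sizes are
independent with the law of `Z₁ / λ_n` conditioned on `{|z| > c}`, and these laws converge to the
normalized restriction of `ν_α`, while the positions are uniform on a grid that fills up
`[0,1]^j`. The map `h_j` is continuous on the data with distinct times inside `(0,1)`, which carry
the limit, and the distance `ε` is absorbed by passing to closed thickenings.
-/

/-! ### Regularly varying tails -/

/-- The complement of the interval `[-c, c]`; these sets generate the sets bounded away from `0`. -/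
def absGt (c : ℝ) : Set ℝ := {y | c < |y|}

theorem mem_absGt {c y : ℝ} : y ∈ absGt c ↔ c < |y| := Iff.rfl

theorem isOpen_absGt (c : ℝ) : IsOpen (absGt c) := isOpen_lt continuous_const continuous_abs

theorem measurableSet_absGt (c : ℝ) : MeasurableSet (absGt c) := (isOpen_absGt c).measurableSet

theorem image_mul_absGt {s : ℝ} (hs : 0 < s) (c : ℝ) :
    (fun x => s * x) '' absGt c = absGt (s * c) := by
  ext y
  simp only [Set.mem_image, mem_absGt]
  constructor
  · rintro ⟨x, hx, rfl⟩
    rw [abs_mul, abs_of_pos hs]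
    exact mul_lt_mul_of_pos_left hx hs
  · intro hy
    refine ⟨y / s, ?_, by field_simp⟩
    rwa [abs_div, abs_of_pos hs, lt_div_iff₀' hs]

/-- The tail function of `|X|`. -/
noncomputable def absTail {Ω : Type*} [MeasurableSpace Ω] (P : Measure Ω) (X : Ω → ℝ) (t : ℝ) : ℝ :=
  P.real {ω | t < |X ω|}

theorem absTail_nonneg {Ω : Type*} [MeasurableSpace Ω] {P : Measure Ω} {X : Ω → ℝ} (t : ℝ) :
    0 ≤ absTail P X t := measureReal_nonneg

theorem absTail_antitone {Ω : Type*} [MeasurableSpace Ω] {P : Measure Ω} [IsFiniteMeasure P]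
    {X : Ω → ℝ} : Antitone (absTail P X) := fun _ _ h =>
  measureReal_mono fun _ hω => lt_of_le_of_lt h hω

theorem areSeparated_zero_le_abs {x : ℝ} (hx : 0 < x) :
    Metric.AreSeparated ({0} : Set ℝ) {y | x ≤ |y|} := by
  refine ⟨ENNReal.ofReal x, by simpa using hx, ?_⟩
  rintro _ rfl y hy
  rw [edist_dist, dist_zero_left]
  exact ENNReal.ofReal_le_ofReal hy

theorem areSeparated_zero_absGt {x : ℝ} (hx : 0 < x) :
    Metric.AreSeparated ({0} : Set ℝ) (absGt x) :=
  (areSeparated_zero_le_abs hx).mono subset_rfl fun _ hy => (mem_absGt.mp hy).le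

theorem TendstoMO.tendsto_measure {S : Type*} [PseudoEMetricSpace S] [MeasurableSpace S]
    {C : Set S} {ν : ℕ → Measure S} {μ : Measure S} (h : TendstoMO C ν μ) {G F : Set S}
    (hG : IsOpen G) (hF : IsClosed F) (hGF : G ⊆ F) (hsep : Metric.AreSeparated C F)
    (hle : μ F ≤ μ G) : Tendsto (fun n => ν n G) atTop (𝓝 (μ G)) := by
  refine tendsto_of_le_liminf_of_limsup_le (h.le_liminf G hG (hsep.mono subset_rfl hGF)) ?_
  calc limsup (fun n => ν n G) atTop ≤ limsup (fun n => ν n F) atTop :=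
        limsup_le_limsup (.of_forall fun n => measure_mono hGF)
    _ ≤ μ F := h.limsup_le F hF hsep
    _ ≤ μ G := hle

section Homogeneous

variable {μ : Measure ℝ} {α : ℝ}
  (hscale : ∀ s : ℝ, 0 < s → ∀ A : Set ℝ, MeasurableSet A → A ⊆ {0}ᶜ →
    μ ((fun x => s * x) '' A) = ENNReal.ofReal (s ^ (-α)) * μ A)

include hscale

theorem measure_absGt_of_homogeneous {x : ℝ} (hx : 0 < x) :
    μ (absGt x) = ENNReal.ofReal (x ^ (-α)) * μ (absGt 1) := by
  rw [← hscale x hx _ (measurableSet_absGt 1), image_mul_absGt hx, mul_one]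
  rintro y hy rfl
  norm_num [mem_absGt] at hy

theorem measure_absGt_one_ne_zero_of_homogeneous (hμ : μ {0}ᶜ ≠ 0) : μ (absGt 1) ≠ 0 := by
  intro h0
  refine hμ (measure_mono_null (t := ⋃ n : ℕ, absGt (1 / ((n : ℝ) + 1))) (fun y hy => ?_) ?_)
  · obtain ⟨n, hn⟩ := exists_nat_one_div_lt (abs_pos.mpr hy)
    exact Set.mem_iUnion.mpr ⟨n, hn⟩
  · refine measure_iUnion_null fun n => ?_
    rw [measure_absGt_of_homogeneous hscale (by positivity), h0, mul_zero]

theorem measure_le_abs_le_of_homogeneous (hfin : μ (absGt 1) ≠ ∞) {x : ℝ} (hx : 0 < x) :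
    μ {y | x ≤ |y|} ≤ μ (absGt x) := by
  have hlim : Tendsto (fun x' : ℝ => ENNReal.ofReal (x' ^ (-α)) * μ (absGt 1)) (𝓝[<] x)
      (𝓝 (ENNReal.ofReal (x ^ (-α)) * μ (absGt 1))) :=
    ENNReal.Tendsto.mul_const (ENNReal.tendsto_ofReal
      ((Real.continuousAt_rpow_const x (-α) (Or.inl hx.ne')).tendsto.mono_left
        nhdsWithin_le_nhds)) (Or.inr hfin)
  rw [measure_absGt_of_homogeneous hscale hx]
  refine ge_of_tendsto hlim ?_
  filter_upwards [Ioo_mem_nhdsLT hx] with x' hx'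
  rw [← measure_absGt_of_homogeneous hscale hx'.1]
  exact measure_mono fun y hy => lt_of_lt_of_le hx'.2 hy

end Homogeneous

theorem tendsto_succ_div_of_antitone {T : ℝ → ℝ} {α : ℝ} (hT : Antitone T) (hT0 : ∀ t, 0 < T t)
    (hlim : ∀ x : ℝ, 0 < x → Tendsto (fun n : ℕ => T (x * n) / T n) atTop (𝓝 (x ^ (-α)))) :
    Tendsto (fun n : ℕ => T (n + 1) / T n) atTop (𝓝 1) := by
  refine tendsto_order.mpr ⟨fun a ha => ?_, fun a ha => .of_forall fun n =>
    lt_of_le_of_lt ((div_le_one (hT0 _)).mpr (hT (by linarith))) ha⟩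
  have hcont : Tendsto (fun x : ℝ => x ^ (-α)) (𝓝[>] 1) (𝓝 1) := by
    simpa using (Real.continuousAt_rpow_const 1 (-α) (Or.inl one_ne_zero)).tendsto.mono_left
      nhdsWithin_le_nhds
  obtain ⟨x, hxa, hx1 : 1 < x⟩ :=
    ((hcont.eventually (eventually_gt_nhds ha)).and self_mem_nhdsWithin).exists
  filter_upwards [(hlim x (by linarith)).eventually (eventually_gt_nhds hxa),
    eventually_ge_atTop ⌈1 / (x - 1)⌉₊] with n hn hxn
  have hsucc : (n : ℝ) + 1 ≤ x * n := by
    have := (div_le_iff₀ (sub_pos.mpr hx1)).mp (Nat.ceil_le.mp hxn)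
    linarith
  exact hn.trans_le (div_le_div_of_nonneg_right (hT hsucc) (hT0 _).le)

theorem tendsto_div_of_antitone_of_nat {F T : ℝ → ℝ} {p : ℝ} (hF : Antitone F) (hT : Antitone T)
    (hF0 : ∀ t, 0 ≤ F t) (hT0 : ∀ t, 0 < T t)
    (h1 : Tendsto (fun n : ℕ => T (n + 1) / T n) atTop (𝓝 1))
    (hp : Tendsto (fun n : ℕ => F n / T n) atTop (𝓝 p)) :
    Tendsto (fun t => F t / T t) atTop (𝓝 p) := by
  have hlo : Tendsto (fun n : ℕ => F (n + 1) / T n) atTop (𝓝 p) := by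
    have := (hp.comp (tendsto_add_atTop_nat 1)).mul h1
    rw [mul_one] at this
    refine this.congr fun n => ?_
    have := (hT0 (n + 1)).ne'
    simp only [Function.comp_apply, Nat.cast_succ]
    field_simp
  have hhi : Tendsto (fun n : ℕ => F n / T (n + 1)) atTop (𝓝 p) := by
    have := hp.div h1 one_ne_zero
    rw [div_one] at this
    exact this.congr fun n => div_div_div_cancel_right₀ (hT0 n).ne' _ _
  have hfl : Tendsto (fun t : ℝ => ⌊t⌋₊) atTop atTop := tendsto_nat_floor_atTop
  refine tendsto_of_tendsto_of_tendsto_of_le_of_le' (hlo.comp hfl) (hhi.comp hfl) ?_ ?_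
  · filter_upwards [eventually_ge_atTop 0] with t ht
    exact div_le_div₀ (hF0 _) (hF (Nat.lt_floor_add_one t).le) (hT0 _) (hT (Nat.floor_le ht))
  · filter_upwards [eventually_ge_atTop 0] with t ht
    exact div_le_div₀ (hF0 _) (hF (Nat.floor_le ht)) (hT0 _) (hT (Nat.lt_floor_add_one t).le)

section Tail

variable {Ω : Type*} [MeasurableSpace Ω] {P : Measure Ω} [IsFiniteMeasure P] {X : Ω → ℝ}
  {α p : ℝ}

theorem map_div_absGt (hX : Measurable X) {n : ℕ} (hn : 1 ≤ n) (x : ℝ) :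
    P.map (fun ω => X ω / n) (absGt x) = ENNReal.ofReal (absTail P X (x * n)) := by
  have hn' : (0 : ℝ) < n := by exact_mod_cast hn
  rw [Measure.map_apply (hX.div_const _) (measurableSet_absGt x), absTail, ofReal_measureReal]
  congr 1
  ext ω
  simp [mem_absGt, abs_div, lt_div_iff₀ hn']

theorem RegVarRV.exists_tendsto_mul_absTail (hX : Measurable X) (h : RegVarRV P X α) :
    ∃ (γ : ℕ → ℝ) (m : ℝ), (∀ n, 1 ≤ n → 0 < γ n) ∧ 0 < m ∧ ∀ x : ℝ, 0 < x →
      Tendsto (fun n : ℕ => γ n * absTail P X (x * n)) atTop (𝓝 (m * x ^ (-α))) := by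
  obtain ⟨γ, β, μ, hγ, hμ0, hμ, hscale⟩ := h
  have hfin : μ (absGt 1) ≠ ∞ :=
    (hμ.finite_limit _ (measurableSet_absGt 1) (areSeparated_zero_absGt one_pos)).ne
  refine ⟨γ, (μ (absGt 1)).toReal, hγ.1, ENNReal.toReal_pos
    (measure_absGt_one_ne_zero_of_homogeneous hscale hμ0) hfin, fun x hx => ?_⟩
  have hlim := hμ.tendsto_measure (isOpen_absGt x) (isClosed_le continuous_const continuous_abs)
    (fun y hy => (mem_absGt.mp hy).le) (areSeparated_zero_le_abs hx)
    (measure_le_abs_le_of_homogeneous hscale hfin hx)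
  rw [measure_absGt_of_homogeneous hscale hx] at hlim
  have hreal := (ENNReal.tendsto_toReal (ENNReal.mul_ne_top ENNReal.ofReal_ne_top hfin)).comp hlim
  rw [ENNReal.toReal_mul, ENNReal.toReal_ofReal (by positivity), mul_comm] at hreal
  refine hreal.congr' ?_
  filter_upwards [eventually_ge_atTop 1] with n hn
  rw [Function.comp_apply, Measure.smul_apply, map_div_absGt hX hn, smul_eq_mul,
    ENNReal.toReal_mul, ENNReal.toReal_ofReal (hγ.1 n hn).le,
    ENNReal.toReal_ofReal (absTail_nonneg _)]

theorem RegVarRV.absTail_pos (hX : Measurable X) (h : RegVarRV P X α) (t : ℝ) :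
    0 < absTail P X t := by
  obtain ⟨γ, m, hγ, hm, hlim⟩ := h.exists_tendsto_mul_absTail hX
  have hone := hlim 1 one_pos
  rw [Real.one_rpow, mul_one] at hone
  obtain ⟨n, hn, hn1, hnt⟩ := ((hone.eventually (eventually_gt_nhds hm)).and
    ((eventually_ge_atTop 1).and (eventually_ge_atTop ⌈t⌉₊))).exists
  rw [one_mul] at hn
  exact (pos_of_mul_pos_right hn (hγ n hn1).le).trans_le (absTail_antitone (Nat.ceil_le.mp hnt))

theorem RegVarRV.tendsto_nat_div (hX : Measurable X) (h : RegVarRV P X α) {x : ℝ} (hx : 0 < x) :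
    Tendsto (fun n : ℕ => absTail P X (x * n) / absTail P X n) atTop (𝓝 (x ^ (-α))) := by
  obtain ⟨γ, m, hγ, hm, hlim⟩ := h.exists_tendsto_mul_absTail hX
  have hone := hlim 1 one_pos
  rw [Real.one_rpow, mul_one] at hone
  have hratio := (hlim x hx).div hone hm.ne'
  rw [mul_div_cancel_left₀ _ hm.ne'] at hratio
  refine hratio.congr' ?_
  filter_upwards [eventually_ge_atTop 1] with n hn
  simp only [Pi.div_apply, one_mul]
  rw [mul_div_mul_left _ _ (hγ n hn).ne']

theorem RegVarRV.tendsto_succ_div (hX : Measurable X) (h : RegVarRV P X α) :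
    Tendsto (fun n : ℕ => absTail P X (n + 1) / absTail P X n) atTop (𝓝 1) :=
  tendsto_succ_div_of_antitone absTail_antitone (h.absTail_pos hX) fun _ => h.tendsto_nat_div hX

theorem RegVarRV.tendsto_div (hX : Measurable X) (h : RegVarRV P X α) {x : ℝ} (hx : 0 < x) :
    Tendsto (fun t : ℝ => absTail P X (x * t) / absTail P X t) atTop (𝓝 (x ^ (-α))) :=
  tendsto_div_of_antitone_of_nat (F := fun t => absTail P X (x * t))
    (fun _ _ hab => absTail_antitone (mul_le_mul_of_nonneg_left hab hx.le)) absTail_antitone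
    (fun _ => absTail_nonneg _) (h.absTail_pos hX) (h.tendsto_succ_div hX) (h.tendsto_nat_div hX hx)

theorem TailBalance.tendsto_right (hX : Measurable X) (h : RegVarRV P X α)
    (hb : TailBalance P X p) :
    Tendsto (fun t : ℝ => P.real {ω | t < X ω} / absTail P X t) atTop (𝓝 p) :=
  tendsto_div_of_antitone_of_nat (F := fun t => P.real {ω | t < X ω})
    (fun _ _ hab => measureReal_mono fun _ hω => lt_of_le_of_lt hab hω) absTail_antitone
    (fun _ => measureReal_nonneg) (h.absTail_pos hX) (h.tendsto_succ_div hX) hb.2.2.1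

theorem TailBalance.tendsto_nat_left (hX : Measurable X) (h : RegVarRV P X α)
    (hb : TailBalance P X p) :
    Tendsto (fun n : ℕ => P.real {ω | X ω ≤ -(n : ℝ)} / absTail P X n) atTop (𝓝 (1 - p)) := by
  have hpos := h.absTail_pos hX
  have hlo := hb.2.2.2
  have hhi : Tendsto (fun n : ℕ => P.real {ω | X ω < -(n : ℝ)} / absTail P X ((n + 1 : ℕ) : ℝ))
      atTop (𝓝 (1 - p)) := by
    have hquot := hlo.div (h.tendsto_succ_div hX) one_ne_zero
    rw [div_one] at hquot
    refine hquot.congr fun n => ?_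
    rw [Nat.cast_succ]
    exact div_div_div_cancel_right₀ (hpos n).ne' _ _
  rw [← tendsto_add_atTop_iff_nat 1]
  refine tendsto_of_tendsto_of_tendsto_of_le_of_le (hlo.comp (tendsto_add_atTop_nat 1)) hhi
    (fun n => ?_) (fun n => ?_)
  · exact div_le_div_of_nonneg_right (measureReal_mono fun ω (hω : X ω < _) => hω.le)
      (hpos _).le
  · refine div_le_div_of_nonneg_right (measureReal_mono fun ω hω => ?_) (hpos _).le
    have hω : X ω ≤ -((n + 1 : ℕ) : ℝ) := hω
    push_cast at hω
    change X ω < -(n : ℝ)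
    linarith

theorem TailBalance.tendsto_left (hX : Measurable X) (h : RegVarRV P X α)
    (hb : TailBalance P X p) :
    Tendsto (fun t : ℝ => P.real {ω | X ω ≤ -t} / absTail P X t) atTop (𝓝 (1 - p)) :=
  tendsto_div_of_antitone_of_nat (F := fun t => P.real {ω | X ω ≤ -t})
    (fun _ _ hab => measureReal_mono fun _ hω => le_trans hω (neg_le_neg hab))
    absTail_antitone (fun _ => measureReal_nonneg) (h.absTail_pos hX) (h.tendsto_succ_div hX)
    (hb.tendsto_nat_left hX h)

end Tail

/-! ### Weak convergence of jump sizes and jump times -/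

theorem tendsto_probabilityMeasure_of_tendsto_Ioi {μ : ℕ → ProbabilityMeasure ℝ}
    {ν : ProbabilityMeasure ℝ}
    (h : ∀ x, Tendsto (fun n => (μ n : Measure ℝ).real (Set.Ioi x)) atTop
      (𝓝 ((ν : Measure ℝ).real (Set.Ioi x)))) :
    Tendsto μ atTop (𝓝 ν) := by
  refine (isPiSystem_Ioc (id : ℝ → ℝ) id).tendsto_probabilityMeasure_of_tendsto_of_mem ?_ ?_ ?_
  · rintro _ ⟨a, b, -, rfl⟩
    exact measurableSet_Ioc
  · intro u hu x hx
    obtain ⟨ε, hε, hball⟩ := Metric.isOpen_iff.mp hu x hx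
    have hsub : Set.Ioc (x - ε / 2) (x + ε / 2) ⊆ u := by
      refine subset_trans (fun y hy => ?_) hball
      rw [Metric.mem_ball, Real.dist_eq, abs_lt]
      constructor <;> linarith [hy.1, hy.2]
    have hlo : x - ε / 2 < x := by linarith
    have hhi : x < x + ε / 2 := by linarith
    exact ⟨_, ⟨_, _, hlo.trans hhi, rfl⟩, Ioc_mem_nhds hlo hhi, hsub⟩
  · rintro _ ⟨a, b, hab : a < b, rfl⟩
    have hdiff (m : ProbabilityMeasure ℝ) : (m : Measure ℝ).real (Set.Ioc a b) =
        (m : Measure ℝ).real (Set.Ioi a) - (m : Measure ℝ).real (Set.Ioi b) := by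
      rw [← measureReal_sdiff (Set.Ioi_subset_Ioi hab.le) measurableSet_Ioi, Set.Ioi_sdiff_Ioi]
    have hlim := (h a).sub (h b)
    simp only [← hdiff] at hlim
    exact NNReal.tendsto_coe.mp hlim

/-- The uniform distribution on the grid `1/n, …, n/n`. -/
noncomputable def gridMeasure (n : ℕ) : Measure ℝ :=
  (n : ℝ≥0∞)⁻¹ • ∑ k : Fin n, Measure.dirac (((k : ℝ) + 1) / n)

theorem gridMeasure_apply (n : ℕ) {s : Set ℝ} (hs : MeasurableSet s) :
    gridMeasure n s = (n : ℝ≥0∞)⁻¹ * ∑ k : Fin n, s.indicator 1 (((k : ℝ) + 1) / n) := by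
  simp [gridMeasure, hs]

theorem isProbabilityMeasure_gridMeasure {n : ℕ} (hn : 1 ≤ n) :
    IsProbabilityMeasure (gridMeasure n) := by
  refine ⟨?_⟩
  rw [gridMeasure_apply n MeasurableSet.univ]
  simp only [Set.indicator_univ, Pi.one_apply, Finset.sum_const, Finset.card_univ,
    Fintype.card_fin, nsmul_eq_mul, mul_one]
  exact ENNReal.inv_mul_cancel (by simpa using (by omega : n ≠ 0)) (by simp)

theorem gridMeasure_Ioi {n : ℕ} (hn : 1 ≤ n) (x : ℝ) :
    gridMeasure n (Set.Ioi x) = (n : ℝ≥0∞)⁻¹ * ((n - ⌊x * n⌋₊ : ℕ) : ℝ≥0∞) := by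
  have hn0 : (0 : ℝ) < n := by exact_mod_cast hn
  have hmem (k : ℕ) : ((k : ℝ) + 1) / n ∈ Set.Ioi x ↔ ⌊x * n⌋₊ ≤ k := by
    rw [Set.mem_Ioi, lt_div_iff₀ hn0, ← Nat.lt_add_one_iff, Nat.floor_lt' k.succ_ne_zero,
      Nat.cast_succ]
  have hfilter : (Finset.range n).filter (fun k => ⌊x * n⌋₊ ≤ k) = Finset.Ico ⌊x * n⌋₊ n := by
    ext k
    simp [and_comm]
  rw [gridMeasure_apply n measurableSet_Ioi, Fin.sum_univ_eq_sum_range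
    (fun k : ℕ => (Set.Ioi x).indicator (1 : ℝ → ℝ≥0∞) (((k : ℝ) + 1) / n))]
  simp only [Set.indicator_apply, hmem, Pi.one_apply]
  rw [Finset.sum_boole, hfilter, Nat.card_Ico]

theorem gridMeasure_real_Ioi {n : ℕ} (hn : 1 ≤ n) (x : ℝ) :
    (gridMeasure n).real (Set.Ioi x) = max (1 - (⌊max x 0 * n⌋₊ : ℝ) / n) 0 := by
  have hn0 : (0 : ℝ) < n := by exact_mod_cast hn
  have hfloor : ⌊x * n⌋₊ = ⌊max x 0 * n⌋₊ := by
    rcases le_total x 0 with hx | hx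
    · rw [max_eq_right hx, zero_mul, Nat.floor_zero,
        Nat.floor_of_nonpos (mul_nonpos_of_nonpos_of_nonneg hx hn0.le)]
    · rw [max_eq_left hx]
  have hsub (k : ℕ) : ((n - k : ℕ) : ℝ) = max ((n : ℝ) - k) 0 := by
    rcases le_total k n with hk | hk
    · rw [Nat.cast_sub hk, max_eq_left (sub_nonneg.mpr (by exact_mod_cast hk))]
    · rw [Nat.sub_eq_zero_of_le hk, max_eq_right (sub_nonpos.mpr (by exact_mod_cast hk)),
        Nat.cast_zero]
  rw [measureReal_def, gridMeasure_Ioi hn, hfloor, ENNReal.toReal_mul, ENNReal.toReal_inv,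
    ENNReal.toReal_natCast, ENNReal.toReal_natCast, hsub, inv_mul_eq_div,
    ← max_div_div_right hn0.le, sub_div, div_self hn0.ne', zero_div]

theorem volume_restrict_Icc_real_Ioi (x : ℝ) :
    (volume.restrict (Set.Icc (0 : ℝ) 1)).real (Set.Ioi x) = max (1 - max x 0) 0 := by
  rw [measureReal_restrict_apply measurableSet_Ioi, ← Real.volume_real_Ioc]
  refine measureReal_congr ?_
  refine ((ae_eq_refl (Set.Ioi x)).inter Ioc_ae_eq_Icc.symm).trans (Filter.EventuallyEq.of_eq ?_)
  rw [← Set.Ioi_inter_Iic, ← Set.inter_assoc, Set.Ioi_inter_Ioi, Set.Ioi_inter_Iic]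

theorem tendsto_gridMeasure_real_Ioi (x : ℝ) :
    Tendsto (fun n => (gridMeasure n).real (Set.Ioi x)) atTop
      (𝓝 ((volume.restrict (Set.Icc (0 : ℝ) 1)).real (Set.Ioi x))) := by
  have hfloor : Tendsto (fun n : ℕ => (⌊max x 0 * n⌋₊ : ℝ) / n) atTop (𝓝 (max x 0)) :=
    (tendsto_nat_floor_mul_div_atTop (le_max_right x 0)).comp tendsto_natCast_atTop_atTop
  rw [volume_restrict_Icc_real_Ioi]
  refine ((hfloor.const_sub 1).max tendsto_const_nhds).congr' ?_
  filter_upwards [eventually_ge_atTop 1] with n hn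
  exact (gridMeasure_real_Ioi hn x).symm

theorem absGt_eq_union (c : ℝ) : absGt c = Set.Iio (-c) ∪ Set.Ioi c := by
  ext y
  rw [mem_absGt, lt_abs, or_comm, lt_neg]
  rfl

theorem absGt_inter_Ioi {c x : ℝ} (hx : c ≤ x) : absGt c ∩ Set.Ioi x = Set.Ioi x :=
  Set.inter_eq_right.mpr fun _ hy => (hx.trans_lt hy).trans_le (le_abs_self _)

theorem absGt_inter_Iic {c x : ℝ} (hx : x < -c) : absGt c ∩ Set.Iic x = Set.Iic x :=
  Set.inter_eq_right.mpr fun _ hy => lt_abs.mpr (Or.inr (lt_neg.mp (lt_of_le_of_lt hy hx)))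

theorem absGt_inter_Ioi_of_mem_Icc {c x : ℝ} (hx : x ∈ Set.Icc (-c) c) :
    absGt c ∩ Set.Ioi x = absGt c ∩ Set.Ioi c := by
  ext y
  simp only [Set.mem_inter_iff, mem_absGt, Set.mem_Ioi, lt_abs]
  constructor
  · rintro ⟨h | h, h'⟩
    · exact ⟨Or.inl h, h⟩
    · linarith [hx.1]
  · rintro ⟨h, h'⟩
    exact ⟨h, hx.2.trans_lt h'⟩

section NuAlpha

variable {α p : ℝ}

instance : SigmaFinite (nuAlpha α p) := SigmaFinite.withDensity_ofReal _

theorem nuAlpha_Ioi {x : ℝ} (hα : 0 < α) (hp0 : 0 ≤ p) (hx : 0 < x) :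
    nuAlpha α p (Set.Ioi x) = ENNReal.ofReal (p * x ^ (-α)) := by
  rw [nuAlpha, withDensity_apply _ measurableSet_Ioi, ← lintegral_pareto_tail hα hp0 hx]
  refine setLIntegral_congr_fun measurableSet_Ioi fun t ht => ?_
  have ht0 : (0 : ℝ) < t := hx.trans ht
  simp [nuDensity, ht0]

theorem nuAlpha_absGt {c : ℝ} (hα : 0 < α) (hp0 : 0 ≤ p) (hp1 : p ≤ 1) (hc : 0 < c) :
    nuAlpha α p (absGt c) = ENNReal.ofReal (c ^ (-α)) := by
  rw [absGt_eq_union, nuAlpha_tails hα hp0 hp1 hc hc, ← add_mul, sub_add_cancel, one_mul]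

theorem nuAlpha_Iic {x : ℝ} (hα : 0 < α) (hp0 : 0 ≤ p) (hp1 : p ≤ 1) (hx : x < 0) :
    nuAlpha α p (Set.Iic x) = ENNReal.ofReal ((1 - p) * (-x) ^ (-α)) := by
  have hx' : 0 < -x := neg_pos.mpr hx
  have hpow : 0 < (-x) ^ (-α) := by positivity
  have hdisj : Disjoint (Set.Iio x) (Set.Ioi (-x)) :=
    Set.disjoint_left.mpr fun t (ha : t < x) (hb : -x < t) => by linarith
  have htails := nuAlpha_tails hα hp0 hp1 hx' hx'
  rw [neg_neg, measure_union hdisj measurableSet_Ioi, nuAlpha_Ioi hα hp0 hx', ENNReal.ofReal_add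
      (mul_nonneg (sub_nonneg.mpr hp1) hpow.le) (mul_nonneg hp0 hpow.le)] at htails
  have hae : Set.Iio x =ᵐ[nuAlpha α p] Set.Iic x :=
    (withDensity_absolutelyContinuous volume _).ae_eq Iio_ae_eq_Iic
  rw [← measure_congr hae]
  exact (ENNReal.add_left_inj ENNReal.ofReal_ne_top).mp htails

theorem isProbabilityMeasure_cond_nuAlpha {c : ℝ} (hα : 0 < α) (hp0 : 0 ≤ p) (hp1 : p ≤ 1)
    (hc : 0 < c) : IsProbabilityMeasure ((nuAlpha α p)[|absGt c]) := by
  have hpow : 0 < c ^ (-α) := by positivity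
  have hmass := nuAlpha_absGt hα hp0 hp1 hc
  refine cond_isProbabilityMeasure_of_finite ?_ (hmass ▸ ENNReal.ofReal_ne_top)
  rw [hmass]
  exact (ENNReal.ofReal_pos.mpr hpow).ne'

end NuAlpha

theorem cond_absGt_real_apply (μ : Measure ℝ) (c : ℝ) (s : Set ℝ) :
    (μ[|absGt c]).real s = μ.real (absGt c ∩ s) / μ.real (absGt c) := by
  rw [measureReal_def, cond_apply (measurableSet_absGt c), ENNReal.toReal_mul, ENNReal.toReal_inv,
    inv_mul_eq_div, measureReal_def, measureReal_def]

section JumpLaw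

variable {Ω : Type*} [MeasurableSpace Ω] {P : Measure Ω} {X : Ω → ℝ} {α p : ℝ}

/-- The distribution of `X / l`. -/
noncomputable def scaledLaw (P : Measure Ω) (X : Ω → ℝ) (l : ℝ) : Measure ℝ :=
  P.map fun ω => l⁻¹ * X ω

theorem scaledLaw_real_Ioi (hX : Measurable X) {l : ℝ} (hl : 0 < l) (x : ℝ) :
    (scaledLaw P X l).real (Set.Ioi x) = P.real {ω | x * l < X ω} := by
  rw [scaledLaw, map_measureReal_apply (hX.const_mul _) measurableSet_Ioi]
  congr 1
  ext ω
  simp [inv_mul_eq_div, lt_div_iff₀ hl]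

theorem scaledLaw_real_Iic (hX : Measurable X) {l : ℝ} (hl : 0 < l) (x : ℝ) :
    (scaledLaw P X l).real (Set.Iic x) = P.real {ω | X ω ≤ x * l} := by
  rw [scaledLaw, map_measureReal_apply (hX.const_mul _) measurableSet_Iic]
  congr 1
  ext ω
  simp [inv_mul_eq_div, div_le_iff₀ hl]

theorem scaledLaw_real_absGt (hX : Measurable X) {l : ℝ} (hl : 0 < l) (c : ℝ) :
    (scaledLaw P X l).real (absGt c) = absTail P X (c * l) := by
  rw [scaledLaw, map_measureReal_apply (hX.const_mul _) (measurableSet_absGt c), absTail]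
  congr 1
  ext ω
  rw [Set.mem_preimage, mem_absGt, abs_mul, abs_inv, abs_of_pos hl, inv_mul_eq_div, lt_div_iff₀ hl]
  exact Iff.rfl

variable [IsProbabilityMeasure P]

theorem isProbabilityMeasure_scaledLaw (hX : Measurable X) (l : ℝ) :
    IsProbabilityMeasure (scaledLaw P X l) :=
  Measure.isProbabilityMeasure_map (hX.const_mul _).aemeasurable

theorem scaledLaw_absGt (hX : Measurable X) {l : ℝ} (hl : 0 < l) (c : ℝ) :
    scaledLaw P X l (absGt c) = ENNReal.ofReal (absTail P X (c * l)) := by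
  have := isProbabilityMeasure_scaledLaw (P := P) hX l
  rw [← scaledLaw_real_absGt hX hl, ofReal_measureReal]

theorem isProbabilityMeasure_cond_scaledLaw (hX : Measurable X) (h : RegVarRV P X α) {l : ℝ}
    (hl : 0 < l) (c : ℝ) : IsProbabilityMeasure ((scaledLaw P X l)[|absGt c]) := by
  have := isProbabilityMeasure_scaledLaw (P := P) hX l
  refine cond_isProbabilityMeasure ?_
  rw [scaledLaw_absGt hX hl]
  exact (ENNReal.ofReal_pos.mpr (h.absTail_pos hX _)).ne'

theorem RegVarRV.tendsto_mul_div_mul (hX : Measurable X) (h : RegVarRV P X α) {y c : ℝ}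
    (hy : 0 < y) (hc : 0 < c) :
    Tendsto (fun l => absTail P X (y * l) / absTail P X (c * l)) atTop
      (𝓝 (y ^ (-α) / c ^ (-α))) :=
  ((h.tendsto_div hX hy).div (h.tendsto_div hX hc) (by positivity)).congr fun l =>
    div_div_div_cancel_right₀ (h.absTail_pos hX l).ne' _ _

theorem tendsto_cond_scaledLaw_real_Ioi_of_le (hX : Measurable X) (h : RegVarRV P X α)
    (hα : 0 < α) (hb : TailBalance P X p) {c y : ℝ} (hc : 0 < c) (hy : c ≤ y) :
    Tendsto (fun l => ((scaledLaw P X l)[|absGt c]).real (Set.Ioi y)) atTop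
      (𝓝 (((nuAlpha α p)[|absGt c]).real (Set.Ioi y))) := by
  have hy0 : 0 < y := hc.trans_le hy
  have hlim : ((nuAlpha α p)[|absGt c]).real (Set.Ioi y) = p * (y ^ (-α) / c ^ (-α)) := by
    rw [cond_absGt_real_apply, absGt_inter_Ioi hy, measureReal_def, measureReal_def,
      nuAlpha_Ioi hα hb.1 hy0, nuAlpha_absGt hα hb.1 hb.2.1 hc, ENNReal.toReal_ofReal
        (mul_nonneg hb.1 (by positivity)), ENNReal.toReal_ofReal (by positivity), mul_div_assoc]
  rw [hlim]
  refine (((hb.tendsto_right hX h).comp (tendsto_id.const_mul_atTop hy0)).mul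
    (h.tendsto_mul_div_mul hX hy0 hc)).congr' ?_
  filter_upwards [eventually_gt_atTop 0] with l hl
  rw [cond_absGt_real_apply, absGt_inter_Ioi hy, scaledLaw_real_absGt hX hl,
    scaledLaw_real_Ioi hX hl]
  exact div_mul_div_cancel₀ (h.absTail_pos hX _).ne'

theorem tendsto_cond_scaledLaw_real_Iic_of_lt (hX : Measurable X) (h : RegVarRV P X α)
    (hα : 0 < α) (hb : TailBalance P X p) {c x : ℝ} (hc : 0 < c) (hx : x < -c) :
    Tendsto (fun l => ((scaledLaw P X l)[|absGt c]).real (Set.Iic x)) atTop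
      (𝓝 (((nuAlpha α p)[|absGt c]).real (Set.Iic x))) := by
  have hx0 : 0 < -x := by linarith
  have hlim : ((nuAlpha α p)[|absGt c]).real (Set.Iic x) =
      (1 - p) * ((-x) ^ (-α) / c ^ (-α)) := by
    rw [cond_absGt_real_apply, absGt_inter_Iic hx, measureReal_def, measureReal_def,
      nuAlpha_Iic hα hb.1 hb.2.1 (neg_pos.mp hx0), nuAlpha_absGt hα hb.1 hb.2.1 hc,
      ENNReal.toReal_ofReal (mul_nonneg (sub_nonneg.mpr hb.2.1) (by positivity)),
      ENNReal.toReal_ofReal (by positivity), mul_div_assoc]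
  rw [hlim]
  refine (((hb.tendsto_left hX h).comp (tendsto_id.const_mul_atTop hx0)).mul
    (h.tendsto_mul_div_mul hX hx0 hc)).congr' ?_
  filter_upwards [eventually_gt_atTop 0] with l hl
  rw [cond_absGt_real_apply, absGt_inter_Iic hx, scaledLaw_real_absGt hX hl,
    scaledLaw_real_Iic hX hl]
  simp only [Function.comp_apply, id, neg_mul, neg_neg]
  rw [← neg_mul]
  exact div_mul_div_cancel₀ (h.absTail_pos hX _).ne'

theorem tendsto_cond_scaledLaw_real_Ioi (hX : Measurable X) (h : RegVarRV P X α) (hα : 0 < α)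
    (hb : TailBalance P X p) {c : ℝ} (hc : 0 < c) (x : ℝ) :
    Tendsto (fun l => ((scaledLaw P X l)[|absGt c]).real (Set.Ioi x)) atTop
      (𝓝 (((nuAlpha α p)[|absGt c]).real (Set.Ioi x))) := by
  rcases le_or_gt c x with hcx | hxc
  · exact tendsto_cond_scaledLaw_real_Ioi_of_le hX h hα hb hc hcx
  rcases le_or_gt (-c) x with hcx' | hxc'
  · simp only [cond_absGt_real_apply, absGt_inter_Ioi_of_mem_Icc ⟨hcx', hxc.le⟩]
    simpa only [cond_absGt_real_apply] using
      tendsto_cond_scaledLaw_real_Ioi_of_le hX h hα hb hc le_rfl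
  · have hcompl (m : Measure ℝ) [IsProbabilityMeasure m] :
        m.real (Set.Ioi x) = 1 - m.real (Set.Iic x) := by
      rw [← Set.compl_Iic, probReal_compl_eq_one_sub measurableSet_Iic]
    have := isProbabilityMeasure_cond_nuAlpha hα hb.1 hb.2.1 hc
    rw [hcompl]
    refine ((tendsto_cond_scaledLaw_real_Iic_of_lt hX h hα hb hc hxc').const_sub 1).congr' ?_
    filter_upwards [eventually_gt_atTop 0] with l hl
    have := isProbabilityMeasure_cond_scaledLaw hX h hl c
    exact (hcompl _).symm

/-- The joint distribution of `j` independent jumps of modulus greater than `c` of `X / l`, and of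
`j` independent uniform grid times. -/
noncomputable def jumpMeasure (P : Measure Ω) (X : Ω → ℝ) (c l : ℝ) (j n : ℕ) :
    Measure ((Fin j → ℝ) × (Fin j → ℝ)) :=
  (Measure.pi fun _ => (scaledLaw P X l)[|absGt c]).prod (Measure.pi fun _ => gridMeasure n)

/-- The weak limit of `jumpMeasure`: `j` independent jumps with law `ν_α` conditioned on `absGt c`,
at `j` independent uniform times. -/
noncomputable def jumpLimit (α p c : ℝ) (j : ℕ) : Measure ((Fin j → ℝ) × (Fin j → ℝ)) :=
  (Measure.pi fun _ => (nuAlpha α p)[|absGt c]).prod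
    (Measure.pi fun _ => volume.restrict (Set.Icc (0 : ℝ) 1))

section Weak

variable (hX : Measurable X) (h : RegVarRV P X α) (hα : 0 < α) (hb : TailBalance P X p) {c : ℝ}
  (hc : 0 < c) {l : ℕ → ℝ} (hl : ∀ n, 1 ≤ n → 0 < l n) (hltop : Tendsto l atTop atTop)

include hX h hα hb hc hl hltop

theorem exists_tendsto_jumpMeasure (j : ℕ) :
    ∃ (μ : ℕ → ProbabilityMeasure ((Fin j → ℝ) × (Fin j → ℝ)))
      (ν : ProbabilityMeasure ((Fin j → ℝ) × (Fin j → ℝ))),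
      (∀ n, (μ n : Measure _) = jumpMeasure P X c (l (n + 1)) j (n + 1)) ∧
      (ν : Measure _) = jumpLimit α p c j ∧ Tendsto μ atTop (𝓝 ν) := by
  let Q : ℕ → ProbabilityMeasure ℝ := fun n => ⟨(scaledLaw P X (l (n + 1)))[|absGt c],
    isProbabilityMeasure_cond_scaledLaw hX h (hl _ n.succ_pos) c⟩
  let Q' : ProbabilityMeasure ℝ := ⟨(nuAlpha α p)[|absGt c],
    isProbabilityMeasure_cond_nuAlpha hα hb.1 hb.2.1 hc⟩
  let L : ℕ → ProbabilityMeasure ℝ := fun n => ⟨gridMeasure (n + 1),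
    isProbabilityMeasure_gridMeasure n.succ_pos⟩
  let L' : ProbabilityMeasure ℝ := ⟨volume.restrict (Set.Icc (0 : ℝ) 1), ⟨by simp⟩⟩
  have hQ : Tendsto Q atTop (𝓝 Q') := tendsto_probabilityMeasure_of_tendsto_Ioi fun x =>
    (tendsto_cond_scaledLaw_real_Ioi hX h hα hb hc x).comp
      (hltop.comp (tendsto_add_atTop_nat 1))
  have hL : Tendsto L atTop (𝓝 L') := tendsto_probabilityMeasure_of_tendsto_Ioi fun x =>
    (tendsto_gridMeasure_real_Ioi x).comp (tendsto_add_atTop_nat 1)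
  have hpi {M : ℕ → ProbabilityMeasure ℝ} {M' : ProbabilityMeasure ℝ}
      (hM : Tendsto M atTop (𝓝 M')) :
      Tendsto (fun n => ProbabilityMeasure.pi fun _ : Fin j => M n) atTop
        (𝓝 (ProbabilityMeasure.pi fun _ : Fin j => M')) :=
    ((ProbabilityMeasure.continuous_pi (ι := Fin j) (α := fun _ => ℝ)).tendsto fun _ => M').comp
      (tendsto_pi_nhds.mpr fun _ => hM)
  exact ⟨fun n => (ProbabilityMeasure.pi fun _ : Fin j => Q n).prod
    (ProbabilityMeasure.pi fun _ : Fin j => L n),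
    (ProbabilityMeasure.pi fun _ : Fin j => Q').prod (ProbabilityMeasure.pi fun _ : Fin j => L'),
    fun n => rfl, rfl,
    (ProbabilityMeasure.continuous_prod.tendsto _).comp ((hpi hQ).prodMk_nhds (hpi hL))⟩

theorem limsup_jumpMeasure_le {j : ℕ} {F : Set ((Fin j → ℝ) × (Fin j → ℝ))} (hF : IsClosed F) :
    limsup (fun n => jumpMeasure P X c (l n) j n F) atTop ≤ jumpLimit α p c j F := by
  obtain ⟨μ, ν, hμ, hν, hlim⟩ := exists_tendsto_jumpMeasure hX h hα hb hc hl hltop j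
  rw [← limsup_nat_add _ 1, ← hν]
  simp only [← hμ]
  exact ProbabilityMeasure.limsup_measure_closed_le_of_tendsto hlim hF

theorem le_liminf_jumpMeasure {j : ℕ} {G : Set ((Fin j → ℝ) × (Fin j → ℝ))} (hG : IsOpen G) :
    jumpLimit α p c j G ≤ liminf (fun n => jumpMeasure P X c (l n) j n G) atTop := by
  obtain ⟨μ, ν, hμ, hν, hlim⟩ := exists_tendsto_jumpMeasure hX h hα hb hc hl hltop j
  rw [← liminf_nat_add _ 1, ← hν]
  simp only [← hμ]
  exact ProbabilityMeasure.le_liminf_measure_open_of_tendsto hlim hG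

end Weak

end JumpLaw

/-! ### Power bounds for regularly varying sequences and tails -/

theorem exists_mul_le_of_halving {g w : ℕ → ℝ} {r : ℝ} (hg : ∀ n, 1 ≤ n → 0 < g n)
    (hw : ∀ n, 1 ≤ n → 0 < w n) (hr : 0 ≤ r) (hgr : ∀ᶠ n : ℕ in atTop, r * g (n / 2) ≤ g n)
    (hwr : ∀ n, 2 ≤ n → w n ≤ r * w (n / 2)) :
    ∃ c : ℝ, 0 < c ∧ ∀ n, 1 ≤ n → c * w n ≤ g n := by
  obtain ⟨N, hN⟩ := eventually_atTop.mp hgr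
  obtain ⟨m, hm, hmin⟩ := (Finset.Icc 1 (max N 2)).exists_min_image (fun n => g n / w n)
    ⟨1, by simp⟩
  have hm1 : 1 ≤ m := (Finset.mem_Icc.mp hm).1
  have hc : 0 < g m / w m := div_pos (hg m hm1) (hw m hm1)
  refine ⟨g m / w m, hc, fun n => ?_⟩
  induction n using Nat.strong_induction_on with
  | _ n ih =>
    intro hn
    rcases le_or_gt n (max N 2) with hnN | hnN
    · exact (le_div_iff₀ (hw n hn)).mp (hmin n (Finset.mem_Icc.mpr ⟨hn, hnN⟩))
    · obtain ⟨hNn, h2n⟩ := max_lt_iff.mp hnN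
      calc g m / w m * w n ≤ g m / w m * (r * w (n / 2)) :=
            mul_le_mul_of_nonneg_left (hwr n h2n.le) hc.le
        _ = r * (g m / w m * w (n / 2)) := by ring
        _ ≤ r * g (n / 2) := mul_le_mul_of_nonneg_left (ih _ (by omega) (by omega)) hr
        _ ≤ g n := hN n hNn.le

theorem rpow_natCast_le_two_rpow_pow_log {n : ℕ} (hn : n ≠ 0) (s : ℝ) :
    (n : ℝ) ^ s ≤ 2 ^ |s| * (2 ^ s) ^ Nat.log 2 n := by
  set m : ℝ := 2 ^ Nat.log 2 n with hm
  have hm0 : 0 < m := by positivity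
  have hmn : m ≤ n := by
    rw [hm]
    exact_mod_cast Nat.pow_log_le_self 2 hn
  have hnm : (n : ℝ) ≤ 2 * m := by
    rw [hm, ← pow_succ']
    exact_mod_cast (Nat.lt_pow_succ_log_self one_lt_two n).le
  have hpow : ((2 : ℝ) ^ s) ^ Nat.log 2 n = m ^ s := by
    rw [hm, ← Real.rpow_natCast, ← Real.rpow_natCast, ← Real.rpow_mul zero_le_two,
      ← Real.rpow_mul zero_le_two, mul_comm]
  rw [hpow]
  rcases le_or_gt 0 s with hs | hs
  · rw [abs_of_nonneg hs, ← Real.mul_rpow zero_le_two hm0.le]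
    exact Real.rpow_le_rpow n.cast_nonneg hnm hs
  · exact (Real.rpow_le_rpow_of_nonpos hm0 hmn hs.le).trans (le_mul_of_one_le_left (by positivity)
      (Real.one_le_rpow one_le_two (abs_nonneg s)))

theorem exists_rpow_le_of_halving {g : ℕ → ℝ} {s : ℝ} (hg : ∀ n, 1 ≤ n → 0 < g n)
    (h : ∀ᶠ n : ℕ in atTop, 2 ^ s * g (n / 2) ≤ g n) :
    ∃ c : ℝ, 0 < c ∧ ∀ n : ℕ, 1 ≤ n → c * (n : ℝ) ^ s ≤ g n := by
  obtain ⟨c, hc, hcg⟩ := exists_mul_le_of_halving (w := fun n => ((2 : ℝ) ^ s) ^ Nat.log 2 n) hg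
    (fun n _ => by positivity) (by positivity) h
    fun n hn => by rw [Nat.log_of_one_lt_of_le one_lt_two hn, pow_succ']
  refine ⟨c / 2 ^ |s|, by positivity, fun n hn => le_trans ?_ (hcg n hn)⟩
  rw [div_mul_eq_mul_div, div_le_iff₀ (by positivity), mul_assoc, mul_comm (_ ^ _ : ℝ) (2 ^ |s|)]
  exact mul_le_mul_of_nonneg_left
    (rpow_natCast_le_two_rpow_pow_log (Nat.one_le_iff_ne_zero.mp hn) s) hc.le

theorem le_rpow_of_antitone_of_nat {f : ℝ → ℝ} (hf : Antitone f) {C s : ℝ} (hC : 0 ≤ C)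
    (hs : 0 ≤ s) (h : ∀ n : ℕ, 1 ≤ n → f n ≤ C * (n : ℝ) ^ (-s)) {t : ℝ} (ht : 1 ≤ t) :
    f t ≤ C * 2 ^ s * t ^ (-s) := by
  have hfloor : t / 2 ≤ ⌊t⌋₊ := by
    have h1 : (1 : ℝ) ≤ ⌊t⌋₊ := by exact_mod_cast (Nat.one_le_floor_iff t).mpr ht
    linarith [Nat.lt_floor_add_one t]
  calc f t ≤ f ⌊t⌋₊ := hf (Nat.floor_le (by linarith))
    _ ≤ C * (⌊t⌋₊ : ℝ) ^ (-s) := h _ ((Nat.one_le_floor_iff t).mpr ht)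
    _ ≤ C * (t / 2) ^ (-s) := mul_le_mul_of_nonneg_left
        (Real.rpow_le_rpow_of_nonpos (by linarith) hfloor (by linarith)) hC
    _ = C * 2 ^ s * t ^ (-s) := by
        rw [Real.div_rpow (by linarith) zero_le_two, Real.rpow_neg zero_le_two, div_inv_eq_mul]
        ring

theorem tendsto_log_pow_mul_rpow_neg (q : ℕ) {s : ℝ} (hs : 0 < s) :
    Tendsto (fun n : ℕ => Real.log n ^ q * (n : ℝ) ^ (-s)) atTop (𝓝 0) := by
  refine ((isLittleO_log_rpow_rpow_atTop (q : ℝ) hs).tendsto_div_nhds_zero.comp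
    tendsto_natCast_atTop_atTop).congr fun n => ?_
  rw [Function.comp_apply, Real.rpow_natCast, Real.rpow_neg n.cast_nonneg, div_eq_mul_inv]

section RegVarSeq

variable {a : ℕ → ℝ} {ρ : ℝ}

theorem RegVarSeq.tendsto_half (h : RegVarSeq a ρ) :
    Tendsto (fun n : ℕ => a (n / 2) / a n) atTop (𝓝 ((2 : ℝ)⁻¹ ^ ρ)) := by
  refine (h.2 2⁻¹ (by norm_num)).congr fun n => ?_
  congr 2
  rw [inv_mul_eq_div]
  exact_mod_cast Nat.floor_div_eq_div (K := ℝ) n 2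

theorem RegVarSeq.exists_rpow_le {s : ℝ} (h : RegVarSeq a ρ) (hs : s < ρ) :
    ∃ c : ℝ, 0 < c ∧ ∀ n : ℕ, 1 ≤ n → c * (n : ℝ) ^ s ≤ a n := by
  refine exists_rpow_le_of_halving h.1 ?_
  have hlt : (2 : ℝ)⁻¹ ^ ρ < (2 ^ s)⁻¹ := by
    rw [← Real.inv_rpow zero_le_two]
    exact Real.rpow_lt_rpow_of_exponent_gt (by norm_num) (by norm_num) hs
  filter_upwards [h.tendsto_half.eventually (eventually_lt_nhds hlt), eventually_ge_atTop 1]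
    with n hn hn1
  rw [div_lt_iff₀ (h.1 n hn1)] at hn
  exact ((le_inv_mul_iff₀ (by positivity)).mp hn.le)

theorem RegVarSeq.exists_mul_rpow_neg_le (h : RegVarSeq a ρ) {β : ℝ} (hβ : 0 < β)
    (hβρ : 1 < β * ρ) :
    ∃ C η : ℝ, 0 < η ∧ ∀ n : ℕ, 1 ≤ n → n * a n ^ (-β) ≤ C * (n : ℝ) ^ (-η) := by
  obtain ⟨s, hβs, hsρ⟩ : ∃ s, 1 < s * β ∧ s < ρ := by
    obtain ⟨s, hs, hsρ⟩ := exists_between ((inv_lt_iff_one_lt_mul₀' hβ).mpr hβρ)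
    exact ⟨s, (inv_lt_iff_one_lt_mul₀ hβ).mp hs, hsρ⟩
  obtain ⟨c, hc, hca⟩ := h.exists_rpow_le hsρ
  refine ⟨c ^ (-β), s * β - 1, by linarith, fun n hn => ?_⟩
  have hn0 : (0 : ℝ) < n := by exact_mod_cast hn
  calc (n : ℝ) * a n ^ (-β) ≤ n * (c * (n : ℝ) ^ s) ^ (-β) := mul_le_mul_of_nonneg_left
        (Real.rpow_le_rpow_of_nonpos (by positivity) (hca n hn) (by linarith)) hn0.le
    _ = c ^ (-β) * ((n : ℝ) ^ (1 : ℝ) * (n : ℝ) ^ (s * -β)) := by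
        rw [Real.mul_rpow hc.le (by positivity), ← Real.rpow_mul hn0.le, Real.rpow_one]
        ring
    _ = c ^ (-β) * (n : ℝ) ^ (-(s * β - 1)) := by
        rw [← Real.rpow_add hn0]
        congr 2
        ring

end RegVarSeq

section Tail

variable {Ω : Type*} [MeasurableSpace Ω] {P : Measure Ω} {X : Ω → ℝ} {α β : ℝ}

theorem lintegral_rpow_lt_top_of_absTail_le [IsFiniteMeasure P] (hX : AEMeasurable X P) {C s : ℝ}
    (hβ0 : 0 < β) (hβs : β < s) (h : ∀ t, 1 ≤ t → absTail P X t ≤ C * t ^ (-s)) :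
    ∫⁻ ω, ENNReal.ofReal (|X ω| ^ β) ∂P < ∞ := by
  have hsmall : IntegrableOn (fun t : ℝ => P.real Set.univ * t ^ (β - 1)) (Set.Ioc 0 1) :=
    ((intervalIntegrable_iff_integrableOn_Ioc_of_le zero_le_one).mp
      (intervalIntegral.intervalIntegrable_rpow' (by linarith))).const_mul _
  have hlarge : IntegrableOn (fun t : ℝ => C * t ^ (β - 1 - s)) (Set.Ioi 1) :=
    (integrableOn_Ioi_rpow_of_lt (by linarith) one_pos).const_mul _
  rw [lintegral_rpow_eq_lintegral_meas_lt_mul P (ae_of_all _ fun _ => abs_nonneg _) hX.norm hβ0,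
    ← Set.Ioc_union_Ioi_eq_Ioi (zero_le_one' ℝ)]
  refine ENNReal.mul_lt_top ENNReal.ofReal_lt_top
    ((lintegral_union_le _ _ _).trans_lt (ENNReal.add_lt_top.mpr ⟨?_, ?_⟩))
  · refine (setLIntegral_mono' measurableSet_Ioc fun t ht => ?_).trans_lt hsmall.lintegral_lt_top
    rw [← ofReal_measureReal, ← ENNReal.ofReal_mul measureReal_nonneg]
    exact ENNReal.ofReal_le_ofReal (mul_le_mul_of_nonneg_right
      (measureReal_mono (Set.subset_univ _)) (Real.rpow_nonneg ht.1.le _))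
  · refine (setLIntegral_mono' measurableSet_Ioi fun t ht => ?_).trans_lt hlarge.lintegral_lt_top
    have ht0 : (0 : ℝ) < t := one_pos.trans ht
    rw [← ofReal_measureReal, ← ENNReal.ofReal_mul measureReal_nonneg, sub_eq_neg_add (β - 1) s,
      Real.rpow_add ht0, ← mul_assoc]
    exact ENNReal.ofReal_le_ofReal (mul_le_mul_of_nonneg_right (h t (le_of_lt ht)) (by positivity))

theorem absTail_le_integral_mul_rpow [IsFiniteMeasure P] {t : ℝ} (hβ : 0 < β) (ht : 0 < t)
    (hint : Integrable (fun ω => |X ω| ^ β) P) :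
    absTail P X t ≤ (∫ ω, |X ω| ^ β ∂P) * t ^ (-β) := by
  rw [Real.rpow_neg ht.le, ← div_eq_mul_inv, le_div_iff₀ (by positivity), mul_comm]
  refine le_trans (mul_le_mul_of_nonneg_left (measureReal_mono fun ω hω => ?_) (by positivity))
    (mul_meas_ge_le_integral_of_nonneg (ae_of_all _ fun ω => by positivity) hint (t ^ β))
  exact Real.rpow_le_rpow ht.le (show t < |X ω| from hω).le hβ.le

theorem integrable_abs_rpow_of_le [IsFiniteMeasure P] (hX : AEMeasurable X P) {γ : ℝ} (hβ : 0 ≤ β)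
    (hβγ : β ≤ γ) (hint : Integrable (fun ω => |X ω| ^ γ) P) :
    Integrable (fun ω => |X ω| ^ β) P := by
  refine ((integrable_const (1 : ℝ)).add hint).mono'
    (hX.norm.pow_const β).aestronglyMeasurable (ae_of_all _ fun ω => ?_)
  have hnonneg : 0 ≤ |X ω| ^ γ := by positivity
  rw [Real.norm_of_nonneg (by positivity), Pi.add_apply]
  rcases le_total |X ω| 1 with h | h
  · linarith [Real.rpow_le_one (abs_nonneg (X ω)) h hβ]
  · linarith [Real.rpow_le_rpow_of_exponent_le h hβγ]

variable [IsProbabilityMeasure P]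

theorem RegVarRV.exists_rpow_le_absTail (hX : Measurable X) (h : RegVarRV P X α)
    {a : ℕ → ℝ} {ρ : ℝ} (ha : RegVarSeq a ρ) (hatop : Tendsto a atTop atTop) :
    ∃ K c : ℝ, 0 < c ∧ ∀ n : ℕ, 1 ≤ n → c * (n : ℝ) ^ K ≤ absTail P X (a n) := by
  have hpos := h.absTail_pos hX
  -- `a n ≤ x * a (n / 2)` eventually, so halving costs the tail at most a constant factor
  set x : ℝ := 2 ^ (ρ + 1) with hx
  have hx0 : 0 < x := by positivity
  have hy0 : 0 < x ^ (-α) / 2 := by positivity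
  have hlt : x⁻¹ < (2 : ℝ)⁻¹ ^ ρ := by
    rw [hx, ← Real.inv_rpow zero_le_two]
    exact Real.rpow_lt_rpow_of_exponent_gt (by norm_num) (by norm_num) (by linarith)
  have htail := (h.tendsto_div hX hx0).comp (hatop.comp (Nat.tendsto_div_const_atTop two_ne_zero))
  refine ⟨Real.logb 2 (x ^ (-α) / 2), exists_rpow_le_of_halving (fun n _ => hpos _) ?_⟩
  rw [Real.rpow_logb (by norm_num) (by norm_num) hy0]
  filter_upwards [htail.eventually (eventually_gt_nhds (half_lt_self (by positivity))),
    ha.tendsto_half.eventually (eventually_gt_nhds hlt), eventually_ge_atTop 1] with n hn hna hn1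
  simp only [Function.comp_apply] at hn
  rw [lt_div_iff₀ (hpos _)] at hn
  rw [lt_div_iff₀ (ha.1 n hn1), inv_mul_lt_iff₀ hx0] at hna
  exact hn.le.trans (absTail_antitone hna.le)

theorem RegVarRV.exists_absTail_natCast_le_rpow (hX : Measurable X) (h : RegVarRV P X α)
    {s : ℝ} (hs : s < α) :
    ∃ C : ℝ, 0 < C ∧ ∀ n : ℕ, 1 ≤ n → absTail P X n ≤ C * (n : ℝ) ^ (-s) := by
  have hpos := h.absTail_pos hX
  have hhalf : ∀ᶠ n : ℕ in atTop, 2 ^ s * (absTail P X (n / 2 : ℕ))⁻¹ ≤ (absTail P X n)⁻¹ := by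
    have htail := (h.tendsto_div hX (x := 2⁻¹) (by norm_num)).comp tendsto_natCast_atTop_atTop
    have hlt : (2 : ℝ) ^ s < 2⁻¹ ^ (-α) := by
      rw [Real.inv_rpow zero_le_two, Real.rpow_neg zero_le_two, inv_inv]
      exact Real.rpow_lt_rpow_of_exponent_lt (by norm_num) hs
    filter_upwards [htail.eventually (eventually_gt_nhds hlt)] with n hn
    simp only [Function.comp_apply] at hn
    rw [lt_div_iff₀ (hpos _)] at hn
    have hmono : absTail P X (2⁻¹ * n) ≤ absTail P X ((n / 2 : ℕ) : ℝ) := by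
      refine absTail_antitone ?_
      rw [inv_mul_eq_div]
      exact_mod_cast Nat.cast_div_le (α := ℝ) (m := n) (n := 2)
    rw [← div_eq_mul_inv, div_le_iff₀ (hpos _), inv_mul_eq_div, le_div_iff₀ (hpos _)]
    exact hn.le.trans hmono
  obtain ⟨c, hc, hcn⟩ := exists_rpow_le_of_halving (g := fun n : ℕ => (absTail P X n)⁻¹)
    (fun n _ => inv_pos.mpr (hpos _)) hhalf
  refine ⟨c⁻¹, inv_pos.mpr hc, fun n hn => ?_⟩
  have hn0 : (0 : ℝ) < n := by exact_mod_cast hn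
  rw [Real.rpow_neg hn0.le, ← mul_inv]
  exact (le_inv_comm₀ (by positivity) (hpos _)).mp (hcn n hn)

theorem RegVarRV.integrable_abs_rpow (hX : Measurable X) (h : RegVarRV P X α) (hβ0 : 0 < β)
    (hβ : β < α) : Integrable (fun ω => |X ω| ^ β) P := by
  obtain ⟨s, hβs, hsα⟩ := exists_between hβ
  obtain ⟨C, hC, hCn⟩ := h.exists_absTail_natCast_le_rpow hX hsα
  refine ⟨(hX.norm.pow_const β).aestronglyMeasurable, ?_⟩
  rw [hasFiniteIntegral_iff_ofReal (ae_of_all _ fun ω => by positivity)]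
  exact lintegral_rpow_lt_top_of_absTail_le hX.aemeasurable hβ0 hβs fun t ht =>
    le_rpow_of_antitone_of_nat (fun _ _ h => absTail_antitone h) hC.le (hβ0.trans hβs).le hCn ht

theorem RegVarRV.exists_integrable_abs_rpow {ρ : ℝ} (hX : Measurable X) (h : RegVarRV P X α)
    (hα : 0 < α) (hfin : evariance X P < ∞ → 1 / 2 < ρ)
    (hinf : evariance X P = ∞ → 1 < α * ρ) :
    ∃ β : ℝ, 0 < β ∧ β ≤ 2 ∧ 1 < β * ρ ∧ Integrable (fun ω => |X ω| ^ β) P := by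
  have hsq : MemLp X 2 P ↔ Integrable (fun ω => |X ω| ^ (2 : ℝ)) P := by
    simp only [memLp_two_iff_integrable_sq hX.aestronglyMeasurable, Real.rpow_two, sq_abs]
  by_cases hL2 : MemLp X 2 P
  · exact ⟨2, two_pos, le_rfl, by linarith [hfin hL2.evariance_lt_top], hsq.mp hL2⟩
  · have hαρ := hinf (evariance_eq_top hX.aestronglyMeasurable hL2)
    have hρ : 0 < ρ := pos_of_mul_pos_right (one_pos.trans hαρ) hα.le
    obtain ⟨β, hρβ, hβα⟩ := exists_between ((inv_lt_iff_one_lt_mul₀ hρ).mpr hαρ)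
    have hβ0 : 0 < β := (inv_pos.mpr hρ).trans hρβ
    have hint := h.integrable_abs_rpow hX hβ0 hβα
    refine ⟨β, hβ0, not_lt.mp fun hβ2 => hL2 ?_, (inv_lt_iff_one_lt_mul₀ hρ).mp hρβ, hint⟩
    exact hsq.mpr (integrable_abs_rpow_of_le hX.aemeasurable zero_le_two hβ2.le hint)

theorem RegVarRV.tendsto_mul_absTail_zero {ρ : ℝ} {lam : ℕ → ℝ} (hX : Measurable X)
    (h : RegVarRV P X α) (hα : 0 < α) (hfin : evariance X P < ∞ → 1 / 2 < ρ)
    (hinf : evariance X P = ∞ → 1 < α * ρ) (hlam : RegVarSeq lam ρ) :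
    Tendsto (fun n : ℕ => n * absTail P X (lam n)) atTop (𝓝 0) := by
  obtain ⟨β, hβ0, -, hβρ, hint⟩ := h.exists_integrable_abs_rpow hX hα hfin hinf
  obtain ⟨C, η, hη, hC⟩ := hlam.exists_mul_rpow_neg_le hβ0 hβρ
  have hlim : Tendsto (fun n : ℕ => (∫ ω, |X ω| ^ β ∂P) * (C * (n : ℝ) ^ (-η))) atTop (𝓝 0) := by
    simpa only [mul_zero, Function.comp_def] using (((tendsto_rpow_neg_atTop hη).comp
      tendsto_natCast_atTop_atTop).const_mul C).const_mul (∫ ω, |X ω| ^ β ∂P)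
  refine squeeze_zero' (Eventually.of_forall fun n => mul_nonneg n.cast_nonneg (absTail_nonneg _))
    ?_ hlim
  filter_upwards [eventually_ge_atTop 1] with n hn
  calc (n : ℝ) * absTail P X (lam n) ≤ n * ((∫ ω, |X ω| ^ β ∂P) * lam n ^ (-β)) :=
        mul_le_mul_of_nonneg_left (absTail_le_integral_mul_rpow hβ0 (hlam.1 n hn) hint)
          n.cast_nonneg
    _ = (∫ ω, |X ω| ^ β ∂P) * (n * lam n ^ (-β)) := by ring
    _ ≤ _ := mul_le_mul_of_nonneg_left (hC n hn) (integral_nonneg fun ω => by positivity)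

end Tail

/-! ### Sums of truncated variables -/

theorem exp_le_one_add_add_sq_mul_exp_abs (x : ℝ) :
    Real.exp x ≤ 1 + x + x ^ 2 * Real.exp |x| := by
  have hexp : 1 ≤ Real.exp |x| := Real.one_le_exp (abs_nonneg x)
  rcases le_or_gt |x| 1 with hx | hx
  · nlinarith [(abs_le.mp (Real.abs_exp_sub_one_sub_id_le hx)).2, sq_nonneg x]
  · rcases lt_abs.mp hx with h | h
    · rw [abs_of_pos (by linarith)]
      nlinarith [Real.exp_pos x, (one_le_sq_iff₀ (by linarith)).mpr h.le]
    · nlinarith [sq_nonneg x, Real.exp_le_one_iff.mpr (show x ≤ 0 by linarith)]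

theorem rpow_eq_rpow_sub_mul_rpow {x : ℝ} (hx : 0 < x) (γ β : ℝ) :
    x ^ γ = x ^ (γ - β) * x ^ β := by
  rw [← Real.rpow_add hx, sub_add_cancel]

theorem rpow_le_rpow_sub_mul_rpow_of_le {x b β γ : ℝ} (hx : 0 ≤ x) (hxb : x ≤ b) (hβ : 0 < β)
    (hβγ : β ≤ γ) : x ^ γ ≤ b ^ (γ - β) * x ^ β := by
  rcases hx.eq_or_lt with rfl | hx
  · simp [Real.zero_rpow hβ.ne', Real.zero_rpow (hβ.trans_le hβγ).ne']
  · rw [rpow_eq_rpow_sub_mul_rpow hx γ β]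
    exact mul_le_mul_of_nonneg_right (Real.rpow_le_rpow hx.le hxb (sub_nonneg.mpr hβγ))
      (by positivity)

theorem rpow_le_rpow_sub_mul_rpow_of_ge {x b β γ : ℝ} (hb : 0 < b) (hbx : b ≤ x) (hγβ : γ ≤ β) :
    x ^ γ ≤ b ^ (γ - β) * x ^ β := by
  have hx : 0 < x := hb.trans_le hbx
  rw [rpow_eq_rpow_sub_mul_rpow hx γ β]
  exact mul_le_mul_of_nonneg_right (Real.rpow_le_rpow_of_nonpos hb hbx (sub_nonpos.mpr hγβ))
    (by positivity)

/-- The truncation at level `b`: `x` if `|x| ≤ b`, and `0` otherwise. -/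
noncomputable def truncAt (b x : ℝ) : ℝ := if |x| ≤ b then x else 0

theorem measurable_truncAt (b : ℝ) : Measurable (truncAt b) :=
  Measurable.ite (measurableSet_le continuous_abs.measurable measurable_const)
    measurable_id measurable_const

theorem abs_truncAt_le {b : ℝ} (hb : 0 ≤ b) (x : ℝ) : |truncAt b x| ≤ b := by
  unfold truncAt
  split_ifs with h
  · exact h
  · simpa using hb

theorem truncAt_neg (b x : ℝ) : truncAt b (-x) = -truncAt b x := by
  unfold truncAt
  rw [abs_neg]
  split_ifs <;> simp

theorem mul_truncAt {c : ℝ} (hc : 0 < c) (b x : ℝ) :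
    c * truncAt b x = truncAt (c * b) (c * x) := by
  unfold truncAt
  simp only [abs_mul, abs_of_pos hc, mul_le_mul_iff_right₀ hc]
  split_ifs <;> simp

theorem abs_truncAt_rpow_le {b β γ : ℝ} (hb : 0 ≤ b) (hβ : 0 < β) (hβγ : β ≤ γ) (x : ℝ) :
    |truncAt b x| ^ γ ≤ b ^ (γ - β) * |x| ^ β := by
  unfold truncAt
  split_ifs with h
  · exact rpow_le_rpow_sub_mul_rpow_of_le (abs_nonneg x) h hβ hβγ
  · rw [abs_zero, Real.zero_rpow (hβ.trans_le hβγ).ne']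
    positivity

theorem abs_sub_truncAt_le {b β : ℝ} (hb : 0 < b) (hβ : 1 ≤ β) (x : ℝ) :
    |x - truncAt b x| ≤ b ^ (1 - β) * |x| ^ β := by
  unfold truncAt
  split_ifs with h
  · rw [sub_self, abs_zero]
    positivity
  · simpa using rpow_le_rpow_sub_mul_rpow_of_ge hb (not_le.mp h).le hβ

/-- The exponent, per unit of `∫ |X| ^ β`, in the bound `mgf_truncAt_le` on the moment generating
function at `θ` of a variable `X` truncated at level `b`. -/
noncomputable def truncMgfExponent (β b θ : ℝ) : ℝ :=
  θ * b ^ (1 - β) + θ ^ 2 * Real.exp (θ * b) * b ^ (2 - β)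

theorem truncMgfExponent_nonneg {b θ : ℝ} (hb : 0 ≤ b) (hθ : 0 ≤ θ) (β : ℝ) :
    0 ≤ truncMgfExponent β b θ := by
  unfold truncMgfExponent
  positivity

theorem truncMgfExponent_scale {b l : ℝ} (hb : 0 ≤ b) (hl : 0 < l) (β θ : ℝ) :
    truncMgfExponent β (b * l) (θ / l) = l ^ (-β) * truncMgfExponent β b θ := by
  have hexp : θ / l * (b * l) = θ * b := by field_simp
  simp only [truncMgfExponent, hexp, Real.mul_rpow hb hl.le, sub_eq_add_neg _ β,
    Real.rpow_add hl, Real.rpow_one, Real.rpow_two]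
  field_simp

theorem tendsto_rpow_neg_mul_truncMgfExponent_log {b η κ : ℝ} (hη : 0 < η) (hκ : κ * b < η)
    (β : ℝ) :
    Tendsto (fun n : ℕ => (n : ℝ) ^ (-η) * truncMgfExponent β b (κ * Real.log n)) atTop
      (𝓝 0) := by
  have hlim := ((tendsto_log_pow_mul_rpow_neg 1 hη).const_mul (κ * b ^ (1 - β))).add
    ((tendsto_log_pow_mul_rpow_neg 2 (sub_pos.mpr hκ)).const_mul (κ ^ 2 * b ^ (2 - β)))
  rw [mul_zero, mul_zero, add_zero] at hlim
  refine hlim.congr' ?_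
  filter_upwards [eventually_gt_atTop 0] with n hn
  have hn0 : (0 : ℝ) < n := by exact_mod_cast hn
  have hexp : Real.exp (κ * Real.log n * b) = (n : ℝ) ^ (κ * b) := by
    rw [Real.rpow_def_of_pos hn0]
    ring_nf
  rw [truncMgfExponent, hexp, neg_sub, Real.rpow_sub hn0, Real.rpow_neg hn0.le]
  ring

section Truncation

variable {Ω : Type*} [MeasurableSpace Ω] {P : Measure Ω} [IsProbabilityMeasure P]
  {X : Ω → ℝ} {b β : ℝ}

theorem integrable_truncAt (hX : Measurable X) (hb : 0 ≤ b) :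
    Integrable (fun ω => truncAt b (X ω)) P :=
  Integrable.of_bound ((measurable_truncAt b).comp hX).aestronglyMeasurable b
    (ae_of_all _ fun _ => abs_truncAt_le hb _)

theorem integrable_truncAt_sq (hX : Measurable X) (hb : 0 ≤ b) :
    Integrable (fun ω => truncAt b (X ω) ^ 2) P :=
  Integrable.of_bound (((measurable_truncAt b).comp hX).pow_const 2).aestronglyMeasurable (b ^ 2)
    (ae_of_all _ fun ω => by
      rw [norm_pow]
      exact pow_le_pow_left₀ (norm_nonneg _) (abs_truncAt_le hb _) 2)

omit [IsProbabilityMeasure P] in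
theorem integral_truncAt_sq_le (hb : 0 ≤ b) (hβ0 : 0 < β) (hβ : β ≤ 2)
    (hint : Integrable (fun ω => |X ω| ^ β) P) :
    ∫ ω, truncAt b (X ω) ^ 2 ∂P ≤ b ^ (2 - β) * ∫ ω, |X ω| ^ β ∂P := by
  rw [← integral_const_mul]
  refine integral_mono_of_nonneg (ae_of_all _ fun ω => sq_nonneg _) (hint.const_mul _)
    (ae_of_all _ fun ω => ?_)
  simpa only [Real.rpow_two, sq_abs] using abs_truncAt_rpow_le hb hβ0 hβ (X ω)

section Moment

variable (hX : Measurable X) (hb : 0 < b) (hβ0 : 0 < β) (hint : Integrable (fun ω => |X ω| ^ β) P)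
  (hmean : Integrable X P → ∫ ω, X ω ∂P = 0)
include hX hb hβ0 hint hmean

theorem abs_integral_truncAt_le :
    |∫ ω, truncAt b (X ω) ∂P| ≤ b ^ (1 - β) * ∫ ω, |X ω| ^ β ∂P := by
  have htrunc := integrable_truncAt (P := P) hX hb.le
  rw [← integral_const_mul]
  rcases le_or_gt β 1 with hβ | hβ
  · refine abs_integral_le_integral_abs.trans (integral_mono htrunc.abs (hint.const_mul _)
      fun ω => ?_)
    simpa only [Real.rpow_one] using abs_truncAt_rpow_le hb.le hβ0 hβ (X ω)
  · have hXint : Integrable X P := by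
      refine (integrable_norm_iff hX.aestronglyMeasurable).mp ?_
      simpa only [Real.norm_eq_abs, Real.rpow_one] using
        integrable_abs_rpow_of_le hX.aemeasurable zero_le_one hβ.le hint
    -- the mean vanishes, so the truncated mean is minus the mean of the removed part
    have htail : ∫ ω, truncAt b (X ω) ∂P = -∫ ω, (X ω - truncAt b (X ω)) ∂P := by
      rw [integral_sub hXint htrunc, hmean hXint, zero_sub, neg_neg]
    rw [htail, abs_neg]
    exact abs_integral_le_integral_abs.trans (integral_mono (hXint.sub htrunc).abs
      (hint.const_mul _) fun ω => abs_sub_truncAt_le hb hβ.le _)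

theorem mgf_truncAt_le (hβ : β ≤ 2) {θ : ℝ} (hθ : 0 ≤ θ) :
    mgf (fun ω => truncAt b (X ω)) P θ ≤
      Real.exp (truncMgfExponent β b θ * ∫ ω, |X ω| ^ β ∂P) := by
  have hlin := (integrable_truncAt (P := P) hX hb.le).const_mul θ
  have hquad := (integrable_truncAt_sq (P := P) hX hb.le).const_mul (θ ^ 2 * Real.exp (θ * b))
  have hpoint : ∀ ω, Real.exp (θ * truncAt b (X ω)) ≤
      1 + θ * truncAt b (X ω) + θ ^ 2 * Real.exp (θ * b) * truncAt b (X ω) ^ 2 := by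
    intro ω
    have hexp : Real.exp |θ * truncAt b (X ω)| ≤ Real.exp (θ * b) := by
      rw [Real.exp_le_exp, abs_mul, abs_of_nonneg hθ]
      exact mul_le_mul_of_nonneg_left (abs_truncAt_le hb.le _) hθ
    linarith [exp_le_one_add_add_sq_mul_exp_abs (θ * truncAt b (X ω)),
      mul_le_mul_of_nonneg_left hexp (sq_nonneg (θ * truncAt b (X ω)))]
  have hmean_le := (le_abs_self _).trans (abs_integral_truncAt_le hX hb hβ0 hint hmean)
  have hsq_le := integral_truncAt_sq_le hb.le hβ0 hβ hint
  calc mgf (fun ω => truncAt b (X ω)) P θ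
      ≤ ∫ ω, (1 + θ * truncAt b (X ω) + θ ^ 2 * Real.exp (θ * b) * truncAt b (X ω) ^ 2) ∂P :=
        integral_mono_of_nonneg (ae_of_all _ fun ω => (Real.exp_pos _).le)
          (((integrable_const 1).add hlin).add hquad) (ae_of_all _ hpoint)
    _ = 1 + θ * ∫ ω, truncAt b (X ω) ∂P +
          θ ^ 2 * Real.exp (θ * b) * ∫ ω, truncAt b (X ω) ^ 2 ∂P := by
        have hone_lin : Integrable (fun ω => 1 + θ * truncAt b (X ω)) P :=
          (integrable_const 1).add hlin
        rw [integral_add hone_lin hquad, integral_add (integrable_const 1) hlin,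
          integral_const_mul, integral_const_mul, integral_const, probReal_univ, one_smul]
    _ ≤ truncMgfExponent β b θ * (∫ ω, |X ω| ^ β ∂P) + 1 := by
        rw [truncMgfExponent]
        linarith [mul_le_mul_of_nonneg_left hmean_le hθ, mul_le_mul_of_nonneg_left hsq_le
          (show 0 ≤ θ ^ 2 * Real.exp (θ * b) by positivity)]
    _ ≤ _ := Real.add_one_le_exp _

end Moment

end Truncation

theorem mgf_sum_range_of_identDistrib {Ω : Type*} [MeasurableSpace Ω] {P : Measure Ω}
    {Y : ℕ → Ω → ℝ} (hmeas : ∀ i, Measurable (Y i)) (hindep : iIndepFun Y P)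
    (hident : ∀ i, IdentDistrib (Y i) (Y 0) P P) (θ : ℝ) (k : ℕ) :
    mgf (fun ω => ∑ i ∈ Finset.range k, Y i ω) P θ = mgf (Y 0) P θ ^ k := by
  rw [← Finset.sum_fn, hindep.mgf_sum hmeas, Finset.prod_eq_pow_card, Finset.card_range]
  exact fun i _ => mgf_congr_of_identDistrib _ _ (hident i) θ

section Sums

variable {Ω : Type*} [MeasurableSpace Ω] {P : Measure Ω} [IsProbabilityMeasure P]
  {Z : ℕ → Ω → ℝ} {β : ℝ}
  (hmeas : ∀ i, Measurable (Z i)) (hindep : iIndepFun Z P)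
  (hident : ∀ i, IdentDistrib (Z i) (Z 0) P P) (hmean : Integrable (Z 0) P → ∫ ω, Z 0 ω ∂P = 0)
  (hβ0 : 0 < β) (hβ : β ≤ 2) (hint : Integrable (fun ω => |Z 0 ω| ^ β) P)
include hmeas hindep hident hmean hβ0 hβ hint

theorem measureReal_sum_truncAt_ge_le {b θ : ℝ} (hb : 0 < b) (hθ : 0 ≤ θ) (x : ℝ) (k : ℕ) :
    P.real {ω | x ≤ ∑ i ∈ Finset.range k, truncAt b (Z i ω)} ≤
      Real.exp (-(θ * x)) *
        Real.exp (k * (truncMgfExponent β b θ * ∫ ω, |Z 0 ω| ^ β ∂P)) := by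
  have htrunc_meas : ∀ i, Measurable (fun ω => truncAt b (Z i ω)) := fun i =>
    (measurable_truncAt b).comp (hmeas i)
  have hsum_le : ∀ ω, ∑ i ∈ Finset.range k, truncAt b (Z i ω) ≤ k * b := fun ω => by
    simpa using Finset.sum_le_card_nsmul (Finset.range k) (fun i => truncAt b (Z i ω)) b
      fun i _ => (le_abs_self _).trans (abs_truncAt_le hb.le _)
  have hexp : Integrable (fun ω => Real.exp (θ * ∑ i ∈ Finset.range k, truncAt b (Z i ω))) P := by
    refine Integrable.of_bound (C := Real.exp (θ * (k * b))) ((Finset.measurable_sum _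
      fun i _ => htrunc_meas i).const_mul θ).exp.aestronglyMeasurable (ae_of_all _ fun ω => ?_)
    rw [Real.norm_eq_abs, Real.abs_exp, Real.exp_le_exp]
    exact mul_le_mul_of_nonneg_left (hsum_le ω) hθ
  have hmgf := mgf_sum_range_of_identDistrib htrunc_meas
    (hindep.comp (fun _ => truncAt b) fun _ => measurable_truncAt b)
    (fun i => (hident i).comp (measurable_truncAt b)) θ k
  refine (measure_ge_le_exp_mul_mgf x hθ hexp).trans ?_
  rw [hmgf, Real.exp_nat_mul, neg_mul]
  exact mul_le_mul_of_nonneg_left (pow_le_pow_left₀ mgf_nonneg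
    (mgf_truncAt_le (hmeas 0) hb hβ0 hint hmean hβ hθ) k) (Real.exp_pos _).le

variable {lam : ℕ → ℝ} (hlam : ∀ n, 1 ≤ n → 0 < lam n) {C η : ℝ} (hη : 0 < η)
  (hCη : ∀ n : ℕ, 1 ≤ n → n * lam n ^ (-β) ≤ C * (n : ℝ) ^ (-η))
  {ε M δ : ℝ} (hε : 0 < ε) (hM : 0 < M) (hδ : 0 < δ) (hδM : M / ε * δ < η)
include hlam hη hCη hε hM hδ hδM

theorem eventually_measureReal_sum_truncAt_ge_le :
    ∀ᶠ n : ℕ in atTop, ∀ k ≤ n,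
      P.real {ω | ε * lam n ≤ ∑ i ∈ Finset.range k, truncAt (δ * lam n) (Z i ω)} ≤
        (n : ℝ) ^ (-M) * Real.exp 1 := by
  set A := ∫ ω, |Z 0 ω| ^ β ∂P
  have hA : 0 ≤ A := integral_nonneg fun ω => by positivity
  have hlim := (tendsto_rpow_neg_mul_truncMgfExponent_log hη hδM β).const_mul (A * C)
  rw [mul_zero] at hlim
  filter_upwards [hlim.eventually (eventually_le_nhds one_pos), eventually_ge_atTop 1]
    with n hn hn1 k hk
  have hl := hlam n hn1
  have hn0 : (0 : ℝ) < n := by exact_mod_cast hn1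
  -- Chernoff's bound at `θ = (M / ε) log n / lam n`, so that `exp (-θ ε lam n) = n ^ (-M)`
  set L := M / ε * Real.log n with hL
  have hL0 : 0 ≤ L :=
    mul_nonneg (div_nonneg hM.le hε.le) (Real.log_nonneg (by exact_mod_cast hn1))
  have hE := truncMgfExponent_nonneg hδ.le hL0 β
  have hfirst : Real.exp (-(L / lam n * (ε * lam n))) = (n : ℝ) ^ (-M) := by
    rw [Real.rpow_def_of_pos hn0, hL]
    congr 1
    field_simp
  have hsecond : k * (truncMgfExponent β (δ * lam n) (L / lam n) * A) ≤ 1 :=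
    calc k * (truncMgfExponent β (δ * lam n) (L / lam n) * A)
        = A * (k * lam n ^ (-β)) * truncMgfExponent β δ L := by
          rw [truncMgfExponent_scale hδ.le hl]
          ring
      _ ≤ A * (n * lam n ^ (-β)) * truncMgfExponent β δ L := by gcongr
      _ ≤ A * (C * (n : ℝ) ^ (-η)) * truncMgfExponent β δ L := by
          gcongr ?_ * _
          exact mul_le_mul_of_nonneg_left (hCη n hn1) hA
      _ = A * C * ((n : ℝ) ^ (-η) * truncMgfExponent β δ L) := by ring
      _ ≤ 1 := hn
  refine (measureReal_sum_truncAt_ge_le hmeas hindep hident hmean hβ0 hβ hint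
    (mul_pos hδ hl) (div_nonneg hL0 hl.le) (ε * lam n) k).trans ?_
  rw [hfirst]
  exact mul_le_mul_of_nonneg_left (Real.exp_le_exp.mpr hsecond) (by positivity)

theorem eventually_measureReal_exists_abs_sum_truncAt_le :
    ∀ᶠ n : ℕ in atTop,
      P.real {ω | ∃ k ≤ n, ε * lam n < |∑ i ∈ Finset.range k, truncAt (δ * lam n) (Z i ω)|} ≤
        4 * Real.exp 1 * (n : ℝ) ^ (1 - M) := by
  have hpos := eventually_measureReal_sum_truncAt_ge_le hmeas hindep hident hmean hβ0 hβ hint hlam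
    hη hCη hε hM hδ hδM
  have hneg := eventually_measureReal_sum_truncAt_ge_le (Z := fun i ω => -Z i ω) (P := P)
    (fun i => (hmeas i).neg) (hindep.comp (fun _ x => -x) fun _ => measurable_neg)
    (fun i => (hident i).comp measurable_neg)
    (fun h => by rw [integral_neg, hmean (by simpa using h.neg), neg_zero])
    hβ0 hβ (by simpa only [abs_neg] using hint) hlam hη hCη hε hM hδ hδM
  filter_upwards [hpos, hneg, eventually_ge_atTop 1] with n hp hn hn1
  have hn0 : (0 : ℝ) < n := by exact_mod_cast hn1
  set A : ℕ → Set Ω := fun k =>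
    {ω | ε * lam n ≤ ∑ i ∈ Finset.range k, truncAt (δ * lam n) (Z i ω)}
  set B : ℕ → Set Ω := fun k =>
    {ω | ε * lam n ≤ ∑ i ∈ Finset.range k, truncAt (δ * lam n) (-Z i ω)} with hB
  have hsub : {ω | ∃ k ≤ n, ε * lam n < |∑ i ∈ Finset.range k, truncAt (δ * lam n) (Z i ω)|} ⊆
      ⋃ k ∈ Finset.range (n + 1), (A k ∪ B k) := by
    rintro ω ⟨k, hk, hlt⟩
    refine Set.mem_biUnion (Finset.mem_coe.mpr (Finset.mem_range.mpr (Nat.lt_succ_of_le hk))) ?_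
    refine (lt_abs.mp hlt).imp (fun h => h.le) fun h => ?_
    simp only [hB, Set.mem_ofPred_eq, truncAt_neg, Finset.sum_neg_distrib]
    exact h.le
  calc _ ≤ P.real (⋃ k ∈ Finset.range (n + 1), (A k ∪ B k)) :=
        measureReal_mono hsub (measure_ne_top _ _)
    _ ≤ ∑ k ∈ Finset.range (n + 1), P.real (A k ∪ B k) := measureReal_biUnion_finset_le _ _
    _ ≤ ∑ k ∈ Finset.range (n + 1), 2 * ((n : ℝ) ^ (-M) * Real.exp 1) := by
        refine Finset.sum_le_sum fun k hk => (measureReal_union_le _ _).trans ?_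
        have hk' : k ≤ n := Nat.le_of_lt_succ (Finset.mem_range.mp hk)
        linarith [hp k hk', hn k hk']
    _ = (n + 1) * (2 * ((n : ℝ) ^ (-M) * Real.exp 1)) := by simp
    _ ≤ (n + n) * (2 * ((n : ℝ) ^ (-M) * Real.exp 1)) := by
        gcongr
        exact_mod_cast hn1
    _ = 4 * Real.exp 1 * (n : ℝ) ^ (1 - M) := by
        rw [sub_eq_add_neg 1 M, Real.rpow_add hn0, Real.rpow_one]
        ring

end Sums

theorem exists_tendsto_small_jumps {Ω : Type*} [MeasurableSpace Ω] {P : Measure Ω}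
    [IsProbabilityMeasure P] {Z : ℕ → Ω → ℝ} {α ρ : ℝ} {lam : ℕ → ℝ}
    (hmeas : ∀ i, Measurable (Z i)) (hindep : iIndepFun Z P)
    (hident : ∀ i, IdentDistrib (Z i) (Z 0) P P) (hα : 0 < α) (hRV : RegVarRV P (Z 0) α)
    (hmean : Integrable (Z 0) P → ∫ ω, Z 0 ω ∂P = 0)
    (hlam : RegVarSeq lam ρ) (hlam_top : Tendsto lam atTop atTop)
    (hfin : evariance (Z 0) P < ∞ → 1 / 2 < ρ) (hinf : evariance (Z 0) P = ∞ → 1 < α * ρ)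
    (j : ℕ) {ε c : ℝ} (hε : 0 < ε) (hc : 0 < c) :
    ∃ δ : ℝ, 0 < δ ∧ δ ≤ c ∧ Tendsto (fun n : ℕ => ((n : ℝ) * absTail P (Z 0) (lam n))⁻¹ ^ j *
      P.real {ω | ∃ k ≤ n, ε * lam n < |∑ i ∈ Finset.range k, truncAt (δ * lam n) (Z i ω)|})
      atTop (𝓝 0) := by
  obtain ⟨β, hβ0, hβ2, hβρ, hint⟩ := hRV.exists_integrable_abs_rpow (hmeas 0) hα hfin hinf
  obtain ⟨C, η, hη, hC⟩ := hlam.exists_mul_rpow_neg_le hβ0 hβρ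
  obtain ⟨K, d, hd, hK⟩ := hRV.exists_rpow_le_absTail (hmeas 0) hlam hlam_top
  -- the normalization is at most of order `n ^ (-(K + 1) * j)`, which fixes the decay to ask for
  set M : ℝ := max 1 (2 - (K + 1) * j)
  have hM : 0 < M := one_pos.trans_le (le_max_left _ _)
  set δ : ℝ := min c (ε * η / (2 * M))
  have hδ : 0 < δ := lt_min hc (by positivity)
  have hδM : M / ε * δ < η :=
    calc M / ε * δ ≤ M / ε * (ε * η / (2 * M)) := by gcongr; exact min_le_right _ _
      _ = η / 2 := by field_simp
      _ < η := half_lt_self hη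
  refine ⟨δ, hδ, min_le_left _ _, ?_⟩
  have hlim : Tendsto (fun n : ℕ => d⁻¹ ^ j * (4 * Real.exp 1) * (n : ℝ) ^ (-(1 : ℝ))) atTop
      (𝓝 0) := by
    simpa only [mul_zero, Function.comp_def] using ((tendsto_rpow_neg_atTop one_pos).comp
      tendsto_natCast_atTop_atTop).const_mul (d⁻¹ ^ j * (4 * Real.exp 1))
  have hnorm_nonneg : ∀ n : ℕ, 0 ≤ ((n : ℝ) * absTail P (Z 0) (lam n))⁻¹ := fun n =>
    inv_nonneg.mpr (mul_nonneg n.cast_nonneg (absTail_nonneg _))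
  refine squeeze_zero' (Eventually.of_forall fun n =>
    mul_nonneg (pow_nonneg (hnorm_nonneg n) j) measureReal_nonneg) ?_ hlim
  filter_upwards [eventually_measureReal_exists_abs_sum_truncAt_le hmeas hindep hident hmean hβ0
    hβ2 hint hlam.1 hη hC hε hM hδ hδM, eventually_ge_atTop 1] with n hn hn1
  have hn0 : (0 : ℝ) < n := by exact_mod_cast hn1
  have hnorm : d * (n : ℝ) ^ (K + 1) ≤ n * absTail P (Z 0) (lam n) := by
    rw [Real.rpow_add hn0, Real.rpow_one]
    linarith [mul_le_mul_of_nonneg_left (hK n hn1) hn0.le]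
  calc _ ≤ (d * (n : ℝ) ^ (K + 1))⁻¹ ^ j * (4 * Real.exp 1 * (n : ℝ) ^ (1 - M)) := by
        gcongr
        exact hnorm_nonneg n
    _ = d⁻¹ ^ j * (4 * Real.exp 1) * (n : ℝ) ^ (1 - M - (K + 1) * j) := by
        rw [mul_inv, mul_pow, Real.rpow_sub hn0 (1 - M), inv_pow ((n : ℝ) ^ (K + 1)),
          ← Real.rpow_mul_natCast hn0.le]
        ring
    _ ≤ d⁻¹ ^ j * (4 * Real.exp 1) * (n : ℝ) ^ (-(1 : ℝ)) := by
        gcongr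
        · exact_mod_cast hn1
        · linarith [le_max_right 1 (2 - (K + 1) * (j : ℝ))]

/-! ### Separated sets -/

/-- Points of `s` and `t` are at distance at least `r` from each other: `Metric.AreSeparated` with
an explicit real constant. -/
def IsSeparatedBy {S : Type*} [PseudoEMetricSpace S] (r : ℝ) (s t : Set S) : Prop :=
  ∀ x ∈ s, ∀ y ∈ t, ENNReal.ofReal r ≤ edist x y

theorem IsSeparatedBy.mono_right {S : Type*} [PseudoEMetricSpace S] {r : ℝ} {s t t' : Set S}
    (h : IsSeparatedBy r s t) (ht : t' ⊆ t) : IsSeparatedBy r s t' :=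
  fun x hx y hy => h x hx y (ht hy)

theorem IsSeparatedBy.areSeparated {S : Type*} [PseudoEMetricSpace S] {r : ℝ} {s t : Set S}
    (h : IsSeparatedBy r s t) (hr : 0 < r) : Metric.AreSeparated s t :=
  ⟨ENNReal.ofReal r, (ENNReal.ofReal_pos.mpr hr).ne', h⟩

theorem IsSeparatedBy.cthickening {S : Type*} [PseudoEMetricSpace S] {r ε : ℝ} {s t : Set S}
    (h : IsSeparatedBy r s t) (hε : 0 ≤ ε) :
    IsSeparatedBy (r - ε) s (Metric.cthickening ε t) := by
  intro x hx y hy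
  rw [ENNReal.ofReal_sub _ hε, tsub_le_iff_right]
  calc ENNReal.ofReal r ≤ Metric.infEDist x t := Metric.le_infEDist.mpr fun w hw => h x hx w hw
    _ ≤ edist x y + Metric.infEDist y t := Metric.infEDist_le_edist_add_infEDist
    _ ≤ edist x y + ENNReal.ofReal ε := add_le_add le_rfl (Metric.mem_cthickening_iff.mp hy)

theorem exists_isSeparatedBy_of_areSeparated {S : Type*} [PseudoEMetricSpace S] {s t : Set S}
    (h : Metric.AreSeparated s t) : ∃ r : ℝ, 0 < r ∧ IsSeparatedBy r s t := by
  obtain ⟨r, hr0, hr⟩ := h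
  have htop : min r 1 ≠ ∞ := ne_top_of_le_ne_top ENNReal.one_ne_top (min_le_right _ _)
  refine ⟨(min r 1).toReal, ENNReal.toReal_pos (by simp [hr0]) htop, fun x hx y hy => ?_⟩
  rw [ENNReal.ofReal_toReal htop]
  exact (min_le_left _ _).trans (hr x hx y hy)

/-! ### Step functions in the Skorohod topology -/

theorem stepFun_apply {j : ℕ} (z u : Fin j → ℝ) (t : unitInterval) :
    stepFun z u t = ∑ i, if u i ≤ (t : ℝ) then z i else 0 := rfl

theorem smul_stepFun {j : ℕ} (c : ℝ) (z u : Fin j → ℝ) :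
    c • stepFun z u = stepFun (fun i => c * z i) u := by
  ext t
  change c * stepFun z u t = _
  simp only [stepFun_apply, Finset.mul_sum, mul_ite, mul_zero]

theorem SkorohodD.edist_le_of_timeChange {f g : SkorohodD} {a : ℝ}
    (τ : unitInterval ≃o unitInterval) (h1 : ∀ t, |f t - g (τ t)| ≤ a)
    (h2 : ∀ t, |((τ t : unitInterval) : ℝ) - t| ≤ a) : edist f g ≤ ENNReal.ofReal a := by
  refine iInf_le_of_le τ (max_le (iSup_le fun t => ?_) (iSup_le fun t => ?_))
  · rw [edist_dist]
    exact ENNReal.ofReal_le_ofReal (h1 t)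
  · rw [edist_dist]
    exact ENNReal.ofReal_le_ofReal (h2 t)

theorem SkorohodD.edist_le_of_forall_abs_le {f g : SkorohodD} {a : ℝ}
    (h : ∀ t, |f t - g t| ≤ a) : edist f g ≤ ENNReal.ofReal a :=
  SkorohodD.edist_le_of_timeChange (OrderIso.refl _) h fun t => by
    simpa using (abs_nonneg _).trans (h t)

theorem edist_stepFun_le {j : ℕ} {z u z' u' : Fin j → ℝ} {a : ℝ}
    (τ : unitInterval ≃o unitInterval)
    (hτ : ∀ i t, u' i ≤ ((τ t : unitInterval) : ℝ) ↔ u i ≤ (t : ℝ))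
    (hz : ∑ i, |z i - z' i| ≤ a) (h2 : ∀ t, |((τ t : unitInterval) : ℝ) - t| ≤ a) :
    edist (stepFun z u) (stepFun z' u') ≤ ENNReal.ofReal a := by
  refine SkorohodD.edist_le_of_timeChange τ (fun t => le_trans ?_ hz) h2
  rw [stepFun_apply, stepFun_apply, ← Finset.sum_sub_distrib]
  refine (Finset.abs_sum_le_sum_abs _ _).trans (Finset.sum_le_sum fun i _ => ?_)
  by_cases h : u i ≤ (t : ℝ)
  · rw [if_pos h, if_pos ((hτ i t).mpr h)]
  · rw [if_neg h, if_neg (mt (hτ i t).mp h)]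
    simp

theorem edist_stepFun_left_le {j : ℕ} (z z' u : Fin j → ℝ) :
    edist (stepFun z u) (stepFun z' u) ≤ ENNReal.ofReal (∑ i, |z i - z' i|) :=
  edist_stepFun_le (OrderIso.refl _) (fun _ _ => Iff.rfl) le_rfl fun t => by
    simpa using Finset.sum_nonneg fun i _ => abs_nonneg (z i - z' i)

theorem continuous_stepFun_left {j : ℕ} (u : Fin j → ℝ) :
    Continuous fun z : Fin j → ℝ => stepFun z u := by
  refine continuous_iff_continuousAt.mpr fun z => ?_
  rw [ContinuousAt, tendsto_iff_edist_tendsto_0]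
  refine tendsto_of_tendsto_of_tendsto_of_le_of_le tendsto_const_nhds
    (h := fun z' => ENNReal.ofReal (∑ i, |z' i - z i|)) ?_ (fun _ => bot_le)
    (fun z' => edist_stepFun_left_le z' z u)
  have : Continuous fun z' : Fin j → ℝ => ENNReal.ofReal (∑ i, |z' i - z i|) :=
    ENNReal.continuous_ofReal.comp (by fun_prop)
  simpa using this.tendsto z

theorem exists_unitInterval_orderIso_of_strictMono {f : ℝ → ℝ} (hcont : Continuous f)
    (hmono : StrictMono f) (h0 : f 0 = 0) (h1 : f 1 = 1) :
    ∃ τ : unitInterval ≃o unitInterval, ∀ t, (τ t : ℝ) = f t := by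
  let F : unitInterval → unitInterval := fun t =>
    ⟨f t, h0.symm.le.trans (hmono.monotone t.2.1), (hmono.monotone t.2.2).trans h1.le⟩
  have hF : StrictMono F := fun s t hst => hmono hst
  have hF_cont : Continuous F := (hcont.comp continuous_subtype_val).subtype_mk _
  have hF_zero : F 0 = 0 := Subtype.ext h0
  have hF_one : F 1 = 1 := Subtype.ext h1
  have hF_surj : Function.Surjective F := fun y =>
    intermediate_value_univ 0 1 hF_cont (by rw [hF_zero, hF_one]; exact ⟨y.2.1, y.2.2⟩)
  exact ⟨hF.orderIsoOfSurjective F hF_surj, fun _ => rfl⟩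

/-- The tent of height one and half-width `η` centred at `c`. -/
noncomputable def tent (η c t : ℝ) : ℝ := max 0 (1 - |t - c| / η)

theorem continuous_tent (η c : ℝ) : Continuous (tent η c) := by
  unfold tent
  fun_prop

@[simp]
theorem tent_self (η c : ℝ) : tent η c c = 1 := by simp [tent]

theorem tent_eq_zero {η c t : ℝ} (hη : 0 < η) (h : η ≤ |t - c|) : tent η c t = 0 :=
  max_eq_left (sub_nonpos.mpr ((one_le_div hη).mpr h))

theorem abs_tent_le_one {η : ℝ} (hη : 0 < η) (c t : ℝ) : |tent η c t| ≤ 1 := by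
  rw [tent, abs_of_nonneg (le_max_left _ _)]
  exact max_le zero_le_one (sub_le_self 1 (div_nonneg (abs_nonneg _) hη.le))

theorem abs_tent_sub_tent_le {η : ℝ} (hη : 0 < η) (c s t : ℝ) :
    |tent η c t - tent η c s| ≤ |t - s| / η := by
  refine (abs_max_sub_max_le_max 0 _ 0 _).trans ?_
  rw [sub_self, abs_zero, max_eq_right (abs_nonneg _), sub_sub_sub_cancel_left, ← sub_div,
    abs_div, abs_of_pos hη, abs_sub_comm t s]
  refine div_le_div_of_nonneg_right ((abs_abs_sub_abs_le_abs_sub _ _).trans (le_of_eq ?_)) hη.le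
  rw [sub_sub_sub_cancel_right]

/-- The piecewise linear map that moves each point `u i` to `u' i` and fixes every point at distance
at least `η` from all the `u i`, provided the `u i` are at mutual distance at least `η`. -/
noncomputable def tentShift {j : ℕ} (η : ℝ) (u u' : Fin j → ℝ) (t : ℝ) : ℝ :=
  t + ∑ i, (u' i - u i) * tent η (u i) t

theorem continuous_tentShift {j : ℕ} (η : ℝ) (u u' : Fin j → ℝ) :
    Continuous (tentShift η u u') :=
  continuous_id.add (continuous_finsetSum _ fun i _ => (continuous_tent η (u i)).const_mul _)

theorem tentShift_of_le {j : ℕ} {η : ℝ} (hη : 0 < η) {u : Fin j → ℝ} (u' : Fin j → ℝ) {t : ℝ}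
    (h : ∀ i, η ≤ |t - u i|) : tentShift η u u' t = t := by
  rw [tentShift, add_eq_left]
  exact Finset.sum_eq_zero fun i _ => by rw [tent_eq_zero hη (h i), mul_zero]

theorem tentShift_apply_self {j : ℕ} {η : ℝ} (hη : 0 < η) {u : Fin j → ℝ} (u' : Fin j → ℝ)
    (h : Pairwise fun i k => η ≤ |u i - u k|) (i : Fin j) : tentShift η u u' (u i) = u' i := by
  rw [tentShift, Finset.sum_eq_single i, tent_self, mul_one, add_sub_cancel]
  · exact fun k _ hk => by rw [tent_eq_zero hη (h hk.symm), mul_zero]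
  · simp

theorem abs_tentShift_sub_le {j : ℕ} {η : ℝ} (hη : 0 < η) (u u' : Fin j → ℝ) (t : ℝ) :
    |tentShift η u u' t - t| ≤ ∑ i, |u' i - u i| := by
  rw [tentShift, add_sub_cancel_left]
  refine (Finset.abs_sum_le_sum_abs _ _).trans (Finset.sum_le_sum fun i _ => ?_)
  rw [abs_mul]
  exact mul_le_of_le_one_right (abs_nonneg _) (abs_tent_le_one hη _ _)

theorem strictMono_tentShift {j : ℕ} {η : ℝ} {u u' : Fin j → ℝ} (h : ∑ i, |u' i - u i| < η) :
    StrictMono (tentShift η u u') := by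
  have hη : 0 < η := (Finset.sum_nonneg fun i _ => abs_nonneg (u' i - u i)).trans_lt h
  intro s t hst
  have hlip : |∑ i, (u' i - u i) * tent η (u i) s - ∑ i, (u' i - u i) * tent η (u i) t| ≤
      (∑ i, |u' i - u i|) * ((t - s) / η) := by
    rw [← Finset.sum_sub_distrib, Finset.sum_mul]
    refine (Finset.abs_sum_le_sum_abs _ _).trans (Finset.sum_le_sum fun i _ => ?_)
    rw [← mul_sub, abs_mul, abs_sub_comm (tent η (u i) s)]
    refine mul_le_mul_of_nonneg_left ?_ (abs_nonneg _)
    simpa only [abs_of_pos (sub_pos.mpr hst)] using abs_tent_sub_tent_le hη (u i) s t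
  have hlt : (∑ i, |u' i - u i|) * ((t - s) / η) < t - s := by
    rw [← mul_div_assoc, div_lt_iff₀ hη, mul_comm]
    exact mul_lt_mul_of_pos_left h (sub_pos.mpr hst)
  simp only [tentShift]
  linarith [(abs_le.mp hlip).2]

theorem exists_gap_of_mem_Ioo {j : ℕ} {u : Fin j → ℝ} (hu : ∀ i, u i ∈ Set.Ioo (0 : ℝ) 1)
    (hinj : Function.Injective u) :
    ∃ η : ℝ, 0 < η ∧ (∀ i, η ≤ |0 - u i|) ∧ (∀ i, η ≤ |1 - u i|) ∧
      Pairwise fun i k => η ≤ |u i - u k| := by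
  have hle : ∀ x y : ℝ, x ≠ y → ∀ᶠ η : ℝ in 𝓝[>] 0, η ≤ |x - y| := fun x y h =>
    nhdsWithin_le_nhds (eventually_le_nhds (abs_pos.mpr (sub_ne_zero.mpr h)))
  refine (eventually_mem_nhdsWithin.and ((eventually_all.mpr fun i => hle _ _ (hu i).1.ne).and
    ((eventually_all.mpr fun i => hle _ _ (hu i).2.ne').and
      (eventually_all.mpr fun i => eventually_all.mpr fun k => ?_)))).exists
  by_cases hik : i = k
  · simp [hik]
  · exact (hle _ _ (hinj.ne hik)).mono fun η hη _ => hη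

theorem exists_timeChange {j : ℕ} {u : Fin j → ℝ} (hu : ∀ i, u i ∈ Set.Ioo (0 : ℝ) 1)
    (hinj : Function.Injective u) :
    ∃ η : ℝ, 0 < η ∧ ∀ u' : Fin j → ℝ, ∑ i, |u' i - u i| < η →
      ∃ τ : unitInterval ≃o unitInterval,
        (∀ i t, u' i ≤ ((τ t : unitInterval) : ℝ) ↔ u i ≤ (t : ℝ)) ∧
        ∀ t, |((τ t : unitInterval) : ℝ) - t| ≤ ∑ i, |u' i - u i| := by
  obtain ⟨η, hη, h0, h1, hpair⟩ := exists_gap_of_mem_Ioo hu hinj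
  refine ⟨η, hη, fun u' hu' => ?_⟩
  have hmono := strictMono_tentShift hu'
  obtain ⟨τ, hτ⟩ := exists_unitInterval_orderIso_of_strictMono (continuous_tentShift η u u') hmono
    (tentShift_of_le hη u' h0) (tentShift_of_le hη u' h1)
  refine ⟨τ, fun i t => ?_, fun t => ?_⟩
  · rw [hτ, ← tentShift_apply_self hη u' hpair i]
    exact hmono.le_iff_le
  · rw [hτ]
    exact abs_tentShift_sub_le hη u u' t

/-- Jump sizes and strictly increasing jump times in the open unit interval. -/
def interiorDomain (j : ℕ) : Set ((Fin j → ℝ) × (Fin j → ℝ)) :=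
  {zu | (∀ i, zu.2 i ∈ Set.Ioo (0 : ℝ) 1) ∧ StrictMono zu.2}

theorem isOpen_interiorDomain (j : ℕ) : IsOpen (interiorDomain j) := by
  have h : interiorDomain j = (⋂ i, {zu | zu.2 i ∈ Set.Ioo (0 : ℝ) 1}) ∩
      ⋂ (i) (k) (_ : i < k), {zu : (Fin j → ℝ) × (Fin j → ℝ) | zu.2 i < zu.2 k} := by
    ext zu
    simp only [interiorDomain, Set.mem_inter_iff, Set.mem_iInter, Set.mem_ofPred_eq]
    exact Iff.rfl
  rw [h]
  refine (isOpen_iInter_of_finite fun i => ?_).inter (isOpen_iInter_of_finite fun i =>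
    isOpen_iInter_of_finite fun k => isOpen_iInter_of_finite fun _ => ?_)
  · exact isOpen_Ioo.preimage (by fun_prop)
  · exact isOpen_lt (by fun_prop) (by fun_prop)

theorem continuousOn_stepFun (j : ℕ) :
    ContinuousOn (fun zu : (Fin j → ℝ) × (Fin j → ℝ) => stepFun zu.1 zu.2) (interiorDomain j) := by
  rintro ⟨z, u⟩ ⟨hu, hmono⟩
  refine ContinuousAt.continuousWithinAt ?_
  obtain ⟨η, hη, hτ⟩ := exists_timeChange hu hmono.injective
  rw [ContinuousAt, tendsto_iff_edist_tendsto_0]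
  have hcont : Continuous fun zu : (Fin j → ℝ) × (Fin j → ℝ) =>
      max (∑ i, |z i - zu.1 i|) (∑ i, |zu.2 i - u i|) := by fun_prop
  have hcont2 : Continuous fun zu : (Fin j → ℝ) × (Fin j → ℝ) => ∑ i, |zu.2 i - u i| := by fun_prop
  have hlim := (ENNReal.continuous_ofReal.comp hcont).tendsto (z, u)
  simp only [Function.comp_apply, sub_self, abs_zero, Finset.sum_const_zero, max_self,
    ENNReal.ofReal_zero] at hlim
  refine tendsto_of_tendsto_of_tendsto_of_le_of_le' tendsto_const_nhds hlim
    (Eventually.of_forall fun _ => bot_le) ?_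
  have hev := (hcont2.tendsto (z, u)).eventually (eventually_lt_nhds (b := η) (by simpa using hη))
  filter_upwards [hev] with zu hzu
  obtain ⟨τ, hτ1, hτ2⟩ := hτ zu.2 hzu
  rw [edist_comm]
  exact edist_stepFun_le τ hτ1 (le_max_left _ _) fun t => (hτ2 t).trans (le_max_right _ _)

theorem stepFun_eq_comp {m n : ℕ} {k : Fin m → Fin n} (hk : Function.Injective k)
    {z : Fin n → ℝ} (u : Fin n → ℝ) (hz : ∀ i ∉ Set.range k, z i = 0) :
    stepFun z u = stepFun (z ∘ k) (u ∘ k) := by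
  ext t
  rw [stepFun_apply, stepFun_apply]
  refine (Fintype.sum_of_injective k hk _ _ (fun i hi => ?_) fun i => rfl).symm
  rw [hz i hi, ite_self]

theorem stepFun_mem_stepAtMost {m n : ℕ} {z u : Fin n → ℝ} (hu : StrictMono u)
    (hu01 : ∀ i, u i ∈ Set.Icc (0 : ℝ) 1)
    (hcard : (Finset.univ.filter fun i => z i ≠ 0).card ≤ m) : stepFun z u ∈ stepAtMost m := by
  set S := Finset.univ.filter fun i => z i ≠ 0
  set k := S.orderEmbOfFin rfl
  have hrange : Set.range k = S := Finset.range_orderEmbOfFin S rfl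
  rw [stepFun_eq_comp k.injective u (fun i hi => by
    by_contra h
    exact hi (by rw [hrange]; simpa [S] using h))]
  refine Set.mem_biUnion (x := S.card) (by simpa using Nat.lt_succ_of_le hcard) ?_
  refine ⟨(z ∘ k, u ∘ k), ⟨fun i => ?_, fun i => hu01 _, hu.comp k.strictMono⟩, rfl⟩
  have : k i ∈ (S : Set (Fin n)) := hrange ▸ Set.mem_range_self i
  simpa [S] using this

theorem le_abs_of_stepFun_mem {j : ℕ} {A : Set SkorohodD} {r : ℝ}
    (hA : IsSeparatedBy r (stepAtMost (j - 1)) A)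
    {z u : Fin j → ℝ} (hu : StrictMono u) (hu01 : ∀ i, u i ∈ Set.Icc (0 : ℝ) 1)
    (h : stepFun z u ∈ A) (i : Fin j) : r ≤ |z i| := by
  have hmem : stepFun (Function.update z i 0) u ∈ stepAtMost (j - 1) := by
    refine stepFun_mem_stepAtMost hu hu01 ?_
    refine (Finset.card_le_card (t := Finset.univ.erase i) fun k hk => ?_).trans (by simp)
    simp only [Finset.mem_filter, Finset.mem_univ, true_and] at hk
    refine Finset.mem_erase.mpr ⟨fun hki => hk ?_, Finset.mem_univ _⟩
    rw [hki, Function.update_self]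
  have h1 := (hA _ hmem _ h).trans (edist_stepFun_left_le _ _ u)
  rw [ENNReal.ofReal_le_ofReal_iff (Finset.sum_nonneg fun _ _ => abs_nonneg _),
    Finset.sum_eq_single i] at h1
  · simpa using h1
  · intro k _ hk
    simp [Function.update_of_ne hk]
  · simp

/-! ### The measures of large jumps -/

theorem restrict_pi_eq_smul_pi_cond {ι E : Type*} [Fintype ι] [MeasurableSpace E] (μ : Measure E)
    [SigmaFinite μ] {s : Set E} (h0 : μ s ≠ 0) (hs : μ s ≠ ∞) :
    (Measure.pi fun _ : ι => μ).restrict (Set.univ.pi fun _ => s) =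
      (μ s) ^ Fintype.card ι • Measure.pi fun _ : ι => μ[|s] := by
  have := cond_isProbabilityMeasure_of_finite h0 hs
  rw [Measure.restrict_pi_pi]
  refine Measure.pi_eq fun t _ => ?_
  have hcond : ∀ i, μ[|s] (t i) = (μ s)⁻¹ * μ.restrict s (t i) := fun i => rfl
  simp only [Measure.smul_apply, Measure.pi_pi, smul_eq_mul, hcond, Finset.prod_mul_distrib,
    Finset.prod_const, Finset.card_univ]
  rw [← mul_assoc, ← mul_pow, ENNReal.mul_inv_cancel h0 hs, one_pow, one_mul]

/-- The jump times of the walk with `n` steps. -/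
noncomputable def walkTime (n : ℕ) (k : Fin n) : ℝ := ((k : ℝ) + 1) / n

theorem strictMono_walkTime (n : ℕ) : StrictMono (walkTime n) := by
  intro i k hik
  have hn : (0 : ℝ) < n := by exact_mod_cast i.pos
  refine div_lt_div_of_pos_right ?_ hn
  have hik' : (i : ℝ) < k := by exact_mod_cast hik
  linarith

theorem walkTime_mem_Icc {n : ℕ} (k : Fin n) : walkTime n k ∈ Set.Icc (0 : ℝ) 1 := by
  have hn : (0 : ℝ) < n := by exact_mod_cast k.pos
  refine ⟨by unfold walkTime; positivity, ?_⟩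
  rw [walkTime, div_le_one hn]
  exact_mod_cast k.2

theorem pi_gridMeasure {n : ℕ} (hn : 1 ≤ n) (j : ℕ) :
    (Measure.pi fun _ : Fin j => gridMeasure n) =
      ((n : ℝ≥0∞) ^ j)⁻¹ • ∑ k : Fin j → Fin n, Measure.dirac (walkTime n ∘ k) := by
  have := isProbabilityMeasure_gridMeasure hn
  refine Measure.pi_eq fun s hs => ?_
  simp only [gridMeasure_apply n (hs _), Finset.prod_mul_distrib, Finset.prod_const,
    Finset.card_univ, Fintype.card_fin]
  rw [Measure.smul_apply, Measure.finsetSum_apply, smul_eq_mul, ENNReal.inv_pow,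
    Finset.prod_univ_sum, Fintype.piFinset_univ]
  congr 1
  refine Finset.sum_congr rfl fun k _ => ?_
  rw [Measure.dirac_apply' _ (MeasurableSet.univ_pi hs)]
  by_cases h : walkTime n ∘ k ∈ Set.univ.pi s
  · rw [Set.indicator_of_mem h]
    refine (Finset.prod_eq_one fun i _ => ?_).symm
    exact Set.indicator_of_mem (h i (Set.mem_univ i)) _
  · rw [Set.indicator_of_notMem h]
    obtain ⟨i, hi⟩ : ∃ i, walkTime n (k i) ∉ s i := by
      by_contra hcon
      push Not at hcon
      exact h fun i _ => hcon i
    exact (Finset.prod_eq_zero (Finset.mem_univ i) (Set.indicator_of_notMem hi _)).symm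

section Law

variable {Ω : Type*} [MeasurableSpace Ω] {P : Measure Ω} [IsProbabilityMeasure P]
  {Z : ℕ → Ω → ℝ} {α : ℝ}

theorem jumpMeasure_apply {X : Ω → ℝ} (hX : Measurable X)
    (h : RegVarRV P X α) {l : ℝ} (hl : 0 < l) (c : ℝ) (j : ℕ) {n : ℕ} (hn : 1 ≤ n)
    {B : Set ((Fin j → ℝ) × (Fin j → ℝ))} (hB : MeasurableSet B) :
    jumpMeasure P X c l j n B = ((n : ℝ≥0∞) ^ j)⁻¹ * ∑ k : Fin j → Fin n,
      Measure.pi (fun _ : Fin j => (scaledLaw P X l)[|absGt c]) {z | (z, walkTime n ∘ k) ∈ B} := by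
  have := isProbabilityMeasure_cond_scaledLaw hX h hl c
  rw [jumpMeasure, pi_gridMeasure hn, Measure.prod_smul_right, Measure.smul_apply, smul_eq_mul,
    ← Measure.sum_fintype, Measure.prod_sum_right, Measure.sum_fintype, Measure.finsetSum_apply]
  congr 1
  refine Finset.sum_congr rfl fun k _ => ?_
  rw [Measure.prod_dirac, Measure.map_apply measurable_prodMk_right hB]
  rfl

theorem ofReal_mul_pow_mul_jumpMeasure {X : Ω → ℝ} (hX : Measurable X)
    (h : RegVarRV P X α) {l : ℝ} (hl : 0 < l) (c : ℝ) (j : ℕ) {n : ℕ} (hn : 1 ≤ n)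
    {B : Set ((Fin j → ℝ) × (Fin j → ℝ))} (hB : MeasurableSet B) :
    ENNReal.ofReal (n * absTail P X (c * l)) ^ j * jumpMeasure P X c l j n B =
      ∑ k : Fin j → Fin n, ENNReal.ofReal (absTail P X (c * l)) ^ j *
        Measure.pi (fun _ : Fin j => (scaledLaw P X l)[|absGt c])
          {z | (z, walkTime n ∘ k) ∈ B} := by
  have hn0 : ((n : ℝ≥0∞) ^ j) ≠ 0 := pow_ne_zero _ (by simpa using (by omega : n ≠ 0))
  have hnt : ((n : ℝ≥0∞) ^ j) ≠ ∞ := ENNReal.pow_ne_top (by simp)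
  rw [jumpMeasure_apply hX h hl c j hn hB, ENNReal.ofReal_mul n.cast_nonneg,
    ENNReal.ofReal_natCast, mul_pow, mul_right_comm, ← mul_assoc, ENNReal.mul_inv_cancel hn0 hnt,
    one_mul, mul_comm, Finset.mul_sum]

/-- The scaled increments of the walk with indices `k`. -/
noncomputable def jumpsAt (Z : ℕ → Ω → ℝ) (l : ℝ) {j n : ℕ} (k : Fin j → Fin n) (ω : Ω) :
    Fin j → ℝ :=
  fun i => l⁻¹ * Z (k i) ω

theorem measurable_jumpsAt (hmeas : ∀ i, Measurable (Z i)) (l : ℝ) {j n : ℕ} (k : Fin j → Fin n) :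
    Measurable (jumpsAt Z l k) :=
  measurable_pi_lambda _ fun _ => (hmeas _).const_mul _

/-- The event that the scaled increments with indices `k` all exceed `c` in absolute value and,
together with their times, lie in `B`. -/
def jumpsIn (Z : ℕ → Ω → ℝ) (l c : ℝ) {j n : ℕ} (B : Set ((Fin j → ℝ) × (Fin j → ℝ)))
    (k : Fin j → Fin n) : Set Ω :=
  {ω | (∀ i, jumpsAt Z l k ω i ∈ absGt c) ∧ (jumpsAt Z l k ω, walkTime n ∘ k) ∈ B}

theorem measurableSet_jumpsIn (hmeas : ∀ i, Measurable (Z i)) (l c : ℝ) {j n : ℕ}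
    {B : Set ((Fin j → ℝ) × (Fin j → ℝ))} (hB : MeasurableSet B) (k : Fin j → Fin n) :
    MeasurableSet (jumpsIn Z l c B k) := by
  have hjumps := measurable_jumpsAt hmeas l k
  have hpi : MeasurableSet (Set.univ.pi fun _ : Fin j => absGt c) :=
    MeasurableSet.univ_pi fun _ => measurableSet_absGt c
  have heq : jumpsIn Z l c B k = jumpsAt Z l k ⁻¹' (Set.univ.pi fun _ => absGt c) ∩
      (fun ω => (jumpsAt Z l k ω, walkTime n ∘ k)) ⁻¹' B := by
    ext ω
    simp [jumpsIn]
  rw [heq]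
  exact (hjumps hpi).inter ((measurable_prodMk_right.comp hjumps) hB)

variable (hmeas : ∀ i, Measurable (Z i)) (hindep : iIndepFun Z P)
  (hident : ∀ i, IdentDistrib (Z i) (Z 0) P P)

include hmeas hindep hident

theorem map_jumpsAt (l : ℝ) {j n : ℕ} {k : Fin j → Fin n}
    (hk : Function.Injective k) :
    P.map (jumpsAt Z l k) = Measure.pi fun _ : Fin j => scaledLaw P (Z 0) l := by
  have hinj : Function.Injective fun i => ((k i : Fin n) : ℕ) := Fin.val_injective.comp hk
  have h1 : iIndepFun (fun (i : Fin j) ω => l⁻¹ * Z (k i) ω) P :=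
    (hindep.precomp hinj).comp (fun _ x => l⁻¹ * x) fun _ => measurable_const_mul _
  have h2 := (iIndepFun_iff_map_fun_eq_pi_map
    fun i => ((hmeas (k i)).const_mul l⁻¹).aemeasurable).mp h1
  refine h2.trans ?_
  congr 1
  ext1 i
  exact ((hident (k i)).comp (measurable_const_mul l⁻¹)).map_eq

theorem measure_jumpsAt (hRV : RegVarRV P (Z 0) α) {l : ℝ} (hl : 0 < l)
    (c : ℝ) {j n : ℕ} {k : Fin j → Fin n} (hk : Function.Injective k) {S : Set (Fin j → ℝ)}
    (hS : MeasurableSet S) :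
    P {ω | (∀ i, jumpsAt Z l k ω i ∈ absGt c) ∧ jumpsAt Z l k ω ∈ S} =
      ENNReal.ofReal (absTail P (Z 0) (c * l)) ^ j *
        Measure.pi (fun _ : Fin j => (scaledLaw P (Z 0) l)[|absGt c]) S := by
  have := isProbabilityMeasure_scaledLaw (P := P) (hmeas 0) l
  have hsc := scaledLaw_absGt (P := P) (hmeas 0) hl c
  have h0 : scaledLaw P (Z 0) l (absGt c) ≠ 0 := by
    rw [hsc]
    simpa using hRV.absTail_pos (hmeas 0) _
  have hpi : MeasurableSet (Set.univ.pi fun _ : Fin j => absGt c) :=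
    MeasurableSet.univ_pi fun _ => measurableSet_absGt c
  have h1 : {ω | (∀ i, jumpsAt Z l k ω i ∈ absGt c) ∧ jumpsAt Z l k ω ∈ S} =
      jumpsAt Z l k ⁻¹' (S ∩ Set.univ.pi fun _ => absGt c) := by
    ext ω
    simp [and_comm]
  rw [h1, ← Measure.map_apply (measurable_jumpsAt hmeas l k) (hS.inter hpi),
    map_jumpsAt hmeas hindep hident l hk, ← Measure.restrict_apply hS,
    restrict_pi_eq_smul_pi_cond _ h0 (measure_ne_top _ _), Measure.smul_apply, smul_eq_mul, hsc,
    Fintype.card_fin]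

theorem sum_measure_jumpsAt_le (hRV : RegVarRV P (Z 0) α) {l : ℝ} (hl : 0 < l)
    (c : ℝ) {j n : ℕ} (hn : 1 ≤ n) {B : Set ((Fin j → ℝ) × (Fin j → ℝ))} (hB : MeasurableSet B) :
    ∑ k : Fin j → Fin n with StrictMono k, P (jumpsIn Z l c B k) ≤
      ENNReal.ofReal (n * absTail P (Z 0) (c * l)) ^ j * jumpMeasure P (Z 0) c l j n B := by
  rw [ofReal_mul_pow_mul_jumpMeasure (hmeas 0) hRV hl c j hn hB]
  refine le_trans (Finset.sum_le_sum fun k hk => le_of_eq ?_)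
    (Finset.sum_le_sum_of_subset (Finset.filter_subset _ _))
  have hk_mono : StrictMono k := (Finset.mem_filter.mp hk).2
  exact measure_jumpsAt hmeas hindep hident hRV hl c hk_mono.injective (measurable_prodMk_right hB)

theorem le_sum_measure_jumpsAt (hRV : RegVarRV P (Z 0) α) {l : ℝ} (hl : 0 < l)
    (c : ℝ) {j n : ℕ} (hn : 1 ≤ n) {B : Set ((Fin j → ℝ) × (Fin j → ℝ))} (hB : MeasurableSet B)
    (hmono : ∀ zu ∈ B, StrictMono zu.2) :
    ENNReal.ofReal (n * absTail P (Z 0) (c * l)) ^ j * jumpMeasure P (Z 0) c l j n B ≤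
    ∑ k : Fin j → Fin n with StrictMono k, P (jumpsIn Z l c B k) := by
  rw [ofReal_mul_pow_mul_jumpMeasure (hmeas 0) hRV hl c j hn hB,
    ← Finset.sum_filter_of_ne (p := fun k : Fin j → Fin n => StrictMono k)]
  · refine Finset.sum_le_sum fun k hk => le_of_eq ?_
    have hk_mono : StrictMono k := (Finset.mem_filter.mp hk).2
    exact (measure_jumpsAt hmeas hindep hident hRV hl c hk_mono.injective
      (measurable_prodMk_right hB)).symm
  · intro k _
    contrapose!
    intro hk
    have hempty : {z : Fin j → ℝ | (z, walkTime n ∘ k) ∈ B} = ∅ :=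
      Set.eq_empty_of_forall_notMem fun z hz => hk fun a b hab =>
        (strictMono_walkTime n).lt_iff_lt.mp (hmono _ hz hab)
    rw [hempty, measure_empty, mul_zero]

theorem measure_forall_mem_absGt {l : ℝ} (hl : 0 < l) (c : ℝ) (S : Finset ℕ) :
    P {ω | ∀ i ∈ S, l⁻¹ * Z i ω ∈ absGt c} =
      ENNReal.ofReal (absTail P (Z 0) (c * l)) ^ S.card := by
  have h1 : iIndepFun (fun i ω => l⁻¹ * Z i ω) P :=
    hindep.comp (fun _ x => l⁻¹ * x) fun _ => measurable_const_mul _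
  have h2 := h1.measure_inter_preimage_eq_mul S (sets := fun _ => absGt c)
    fun _ _ => measurableSet_absGt c
  have h3 : {ω | ∀ i ∈ S, l⁻¹ * Z i ω ∈ absGt c} =
      ⋂ i ∈ S, (fun ω => l⁻¹ * Z i ω) ⁻¹' absGt c := by
    ext ω
    simp
  rw [h3, h2]
  refine Finset.prod_eq_pow_card fun i _ => ?_
  rw [← scaledLaw_absGt (hmeas 0) hl, scaledLaw,
    Measure.map_apply ((hmeas 0).const_mul _) (measurableSet_absGt c)]
  exact ((hident i).comp (measurable_const_mul l⁻¹)).measure_mem_eq (measurableSet_absGt c)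

end Law

theorem ae_apply_ne_apply {ι : Type*} [Fintype ι] {i k : ι} (hik : i ≠ k) :
    ∀ᵐ u : ι → ℝ, u i ≠ u k := by
  classical
  set V := LinearMap.ker (LinearMap.proj (R := ℝ) (φ := fun _ : ι => ℝ) i - LinearMap.proj k)
  have hV : volume (V : Set (ι → ℝ)) = 0 := by
    refine Measure.addHaar_submodule _ _ fun htop => ?_
    have hmem : (Pi.single i 1 : ι → ℝ) ∈ V := htop ▸ Submodule.mem_top
    simp [V, hik.symm] at hmem
  filter_upwards [measure_eq_zero_iff_ae_notMem.mp hV] with u hu heq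
  exact hu (by simp [V, heq])

section Limit

variable {α p : ℝ} {j : ℕ}

theorem smul_jumpLimit (hα : 0 < α) (hp0 : 0 ≤ p) (hp1 : p ≤ 1) {c : ℝ} (hc : 0 < c) :
    ENNReal.ofReal (c ^ (-α)) ^ j • jumpLimit α p c j =
      ((Measure.pi fun _ : Fin j => nuAlpha α p).prod volume).restrict
        ((Set.univ.pi fun _ => absGt c) ×ˢ (Set.univ.pi fun _ => Set.Icc (0 : ℝ) 1)) := by
  have hν := nuAlpha_absGt hα hp0 hp1 hc
  have hcα : 0 < c ^ (-α) := by positivity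
  have := isProbabilityMeasure_cond_nuAlpha hα hp0 hp1 hc
  rw [← Measure.prod_restrict, restrict_pi_eq_smul_pi_cond _ (by rw [hν]; simpa using hcα)
    (by rw [hν]; exact ENNReal.ofReal_ne_top), hν, Fintype.card_fin,
    Measure.prod_smul_left, volume_pi,
    Measure.restrict_pi_pi]
  rfl

theorem ae_mem_interiorDomain (μ : Measure (Fin j → ℝ)) :
    ∀ᵐ zu ∂(μ.prod (volume : Measure (Fin j → ℝ))),
      Monotone zu.2 → (∀ i, zu.2 i ∈ Set.Icc (0 : ℝ) 1) → zu ∈ interiorDomain j := by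
  have hgen : ∀ᵐ u : Fin j → ℝ, (∀ i, u i ≠ 0 ∧ u i ≠ 1) ∧ ∀ i k, i ≠ k → u i ≠ u k := by
    refine (ae_all_iff.mpr fun i => ?_).and (ae_all_iff.mpr fun i => ae_all_iff.mpr fun k => ?_)
    · rw [volume_pi]
      exact (Measure.ae_eval_ne _ i 0).and (Measure.ae_eval_ne _ i 1)
    · exact ae_all_iff.mpr ae_apply_ne_apply
  have hsnd := Measure.quasiMeasurePreserving_snd (μ := μ) (ν := (volume : Measure (Fin j → ℝ)))
  filter_upwards [hsnd.ae hgen] with zu hzu hmono hIcc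
  refine ⟨fun i => ⟨lt_of_le_of_ne (hIcc i).1 (hzu.1 i).1.symm,
    lt_of_le_of_ne (hIcc i).2 (hzu.1 i).2⟩, hmono.strictMono_of_injective fun i k hik => ?_⟩
  by_contra hne
  exact hzu.2 i k hne hik

theorem measurableSet_nonzero_interiorDomain (j : ℕ) :
    MeasurableSet ({zu : (Fin j → ℝ) × (Fin j → ℝ) | ∀ i, zu.1 i ≠ 0} ∩ interiorDomain j) := by
  refine MeasurableSet.inter ?_ (isOpen_interiorDomain j).measurableSet
  have : {zu : (Fin j → ℝ) × (Fin j → ℝ) | ∀ i, zu.1 i ≠ 0} = ⋂ i, {zu | zu.1 i = 0}ᶜ := by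
    ext zu
    simp
  rw [this]
  refine MeasurableSet.iInter fun i => MeasurableSet.compl ?_
  exact measurableSet_eq_fun (by fun_prop) (by fun_prop)

theorem limitMeasure_apply {A : Set SkorohodD} (hA : MeasurableSet A) :
    limitMeasure α p j A = ((Measure.pi fun _ : Fin j => nuAlpha α p).prod volume)
      ({zu | (∀ i, zu.1 i ≠ 0) ∧ stepFun zu.1 zu.2 ∈ A} ∩ interiorDomain j) := by
  set μ := (Measure.pi fun _ : Fin j => nuAlpha α p).prod (volume : Measure (Fin j → ℝ))
  have hae : jumpDomain j =ᵐ[μ]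
      ({zu | ∀ i, zu.1 i ≠ 0} ∩ interiorDomain j : Set ((Fin j → ℝ) × (Fin j → ℝ))) := by
    refine eventuallyEq_set.mpr ?_
    filter_upwards [ae_mem_interiorDomain (Measure.pi fun _ : Fin j => nuAlpha α p)] with zu hzu
    constructor
    · rintro ⟨h1, h2, h3⟩
      exact ⟨h1, hzu h3.monotone h2⟩
    · rintro ⟨h1, h2, h3⟩
      exact ⟨h1, fun i => Set.Ioo_subset_Icc_self (h2 i), h3⟩
  have haem : AEMeasurable (fun zu : (Fin j → ℝ) × (Fin j → ℝ) => stepFun zu.1 zu.2)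
      (μ.restrict ({zu | ∀ i, zu.1 i ≠ 0} ∩ interiorDomain j)) :=
    ((continuousOn_stepFun j).aemeasurable (isOpen_interiorDomain j).measurableSet).mono_measure
      (Measure.restrict_mono Set.inter_subset_right le_rfl)
  rw [limitMeasure, Measure.restrict_congr_set hae, Measure.map_apply_of_aemeasurable haem hA,
    Measure.restrict_apply' (measurableSet_nonzero_interiorDomain j)]
  congr 1
  ext zu
  simp only [Set.mem_inter_iff, Set.mem_preimage, Set.mem_ofPred_eq]
  tauto

end Limit

/-! ### Comparison of the walk with its large jumps -/

section Path

theorem sub_truncAt_of_le {b x : ℝ} (h : |x| ≤ b) : x - truncAt b x = 0 := by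
  rw [truncAt, if_pos h, sub_self]

theorem sub_truncAt_of_lt {b x : ℝ} (h : b < |x|) : x - truncAt b x = x := by
  rw [truncAt, if_neg (not_le.mpr h), sub_zero]

theorem walkTime_le_iff {n : ℕ} (i : Fin n) {t : ℝ} (ht : 0 ≤ t) :
    walkTime n i ≤ t ↔ (i : ℕ) < ⌊t * n⌋₊ := by
  have hn : (0 : ℝ) < n := by exact_mod_cast i.pos
  rw [walkTime, div_le_iff₀ hn, ← Nat.succ_le_iff, Nat.le_floor_iff (mul_nonneg ht hn.le),
    Nat.cast_succ]

theorem floor_mul_le (n : ℕ) (t : unitInterval) : ⌊(t : ℝ) * n⌋₊ ≤ n :=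
  Nat.floor_le_of_le (mul_le_of_le_one_left n.cast_nonneg t.2.2)

theorem stepFun_walkTime_apply (w : ℕ → ℝ) (n : ℕ) (t : unitInterval) :
    stepFun (fun i : Fin n => w i) (walkTime n) t = ∑ i ∈ Finset.range ⌊(t : ℝ) * n⌋₊, w i := by
  simp only [stepFun_apply, walkTime_le_iff _ t.2.1]
  rw [Fin.sum_univ_eq_sum_range (fun i => if i < ⌊(t : ℝ) * n⌋₊ then w i else 0),
    ← Finset.sum_filter]
  refine Finset.sum_congr ?_ fun _ _ => rfl
  ext i
  have := floor_mul_le n t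
  simp only [Finset.mem_filter, Finset.mem_range]
  omega

/-- The indices of the first `n` terms of `w` that exceed `δ` in absolute value. -/
noncomputable def largeJumps (n : ℕ) (δ : ℝ) (w : ℕ → ℝ) : Finset (Fin n) :=
  Finset.univ.filter fun i => δ < |w i|

theorem mem_largeJumps {n : ℕ} {δ : ℝ} {w : ℕ → ℝ} {i : Fin n} :
    i ∈ largeJumps n δ w ↔ δ < |w i| := by
  simp [largeJumps]

/-- Jump data with all jumps larger than `c` that lead into `A`. -/
def jumpSet (j : ℕ) (c : ℝ) (A : Set SkorohodD) : Set ((Fin j → ℝ) × (Fin j → ℝ)) :=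
  {zu | (∀ i, zu.1 i ∈ absGt c) ∧ StrictMono zu.2 ∧ (∀ i, zu.2 i ∈ Set.Icc (0 : ℝ) 1) ∧
    stepFun zu.1 zu.2 ∈ A}

variable {j n : ℕ} {w : ℕ → ℝ} {δ ε r c : ℝ} {F : Set SkorohodD}
  (hsum : ∀ k ≤ n, |∑ i ∈ Finset.range k, truncAt δ (w i)| ≤ ε)

include hsum

theorem edist_stepFun_sub_truncAt_le :
    edist (stepFun (fun i : Fin n => w i) (walkTime n))
      (stepFun (fun i : Fin n => w i - truncAt δ (w i)) (walkTime n)) ≤ ENNReal.ofReal ε := by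
  refine SkorohodD.edist_le_of_forall_abs_le fun t => ?_
  rw [stepFun_walkTime_apply, stepFun_walkTime_apply (fun i => w i - truncAt δ (w i)),
    ← Finset.sum_sub_distrib]
  simpa only [sub_sub_cancel] using hsum _ (floor_mul_le n t)

theorem edist_stepFun_comp_le {k : Fin j → Fin n} (hk : Function.Injective k)
    (hrange : Set.range k = largeJumps n δ w) :
    edist (stepFun (fun i : Fin n => w i) (walkTime n))
      (stepFun (fun i => w (k i)) (walkTime n ∘ k)) ≤ ENNReal.ofReal ε := by
  have hlarge : ∀ i, i ∈ Set.range k ↔ δ < |w i| := fun i => by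
    rw [hrange, Finset.mem_coe, mem_largeJumps]
  have hcomp := stepFun_eq_comp hk (z := fun i : Fin n => w i - truncAt δ (w i)) (walkTime n)
    fun i hi => sub_truncAt_of_le (not_lt.mp (mt (hlarge i).mpr hi))
  have hjump : (fun i : Fin n => w i - truncAt δ (w i)) ∘ k = fun i => w (k i) :=
    funext fun i => sub_truncAt_of_lt ((hlarge _).mp (Set.mem_range_self i))
  rw [← hjump, ← hcomp]
  exact edist_stepFun_sub_truncAt_le hsum

variable (hF : stepFun (fun i : Fin n => w i) (walkTime n) ∈ F) (hε : 0 ≤ ε)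

include hF hε

theorem lt_card_largeJumps {m : ℕ} (hsep : IsSeparatedBy r (stepAtMost m) F) (hεr : ε < r) :
    m < (largeJumps n δ w).card := by
  by_contra! hcard
  have hmem : stepFun (fun i : Fin n => w i - truncAt δ (w i)) (walkTime n) ∈ stepAtMost m := by
    refine stepFun_mem_stepAtMost (strictMono_walkTime n) walkTime_mem_Icc
      ((Finset.card_le_card fun i hi => ?_).trans hcard)
    rw [mem_largeJumps]
    by_contra! hsmall
    exact (Finset.mem_filter.mp hi).2 (sub_truncAt_of_le hsmall)
  have hle := (hsep _ hmem _ hF).trans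
    ((edist_comm _ _).trans_le (edist_stepFun_sub_truncAt_le hsum))
  exact hεr.not_ge ((ENNReal.ofReal_le_ofReal_iff hε).mp hle)

theorem exists_mem_jumpSet (hsep : IsSeparatedBy r (stepAtMost (j - 1)) F) (hr : c + ε < r)
    (hcard : (largeJumps n δ w).card = j) :
    ∃ k : Fin j → Fin n, StrictMono k ∧
      (fun i => w (k i), walkTime n ∘ k) ∈ jumpSet j c (Metric.cthickening ε F) := by
  set k := (largeJumps n δ w).orderEmbOfFin hcard
  have hrange : Set.range k = largeJumps n δ w := Finset.range_orderEmbOfFin _ hcard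
  have hedist := edist_stepFun_comp_le hsum k.injective hrange
  have hmem : stepFun (fun i => w (k i)) (walkTime n ∘ k) ∈ Metric.cthickening ε F :=
    Metric.mem_cthickening_of_edist_le _ _ _ _ hF ((edist_comm _ _).trans_le hedist)
  have hmono : StrictMono (walkTime n ∘ k) := (strictMono_walkTime n).comp k.strictMono
  have hIcc : ∀ i, (walkTime n ∘ k) i ∈ Set.Icc (0 : ℝ) 1 := fun i => walkTime_mem_Icc _
  refine ⟨k, k.strictMono, fun i => ?_, hmono, hIcc, hmem⟩
  exact (lt_sub_iff_add_lt.mpr hr).trans_le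
    (le_abs_of_stepFun_mem (hsep.cthickening hε) hmono hIcc hmem i)

end Path

section Walk

variable {Ω : Type*} {Z : ℕ → Ω → ℝ}

theorem inv_smul_walkPath (Z : ℕ → Ω → ℝ) (n : ℕ) (l : ℝ) (ω : Ω) :
    l⁻¹ • walkPath Z n ω = stepFun (fun i : Fin n => l⁻¹ * Z i ω) (walkTime n) :=
  smul_stepFun _ _ _

/-- The event that some partial sum of the increments truncated at `δ * l` exceeds `ε * l`. -/
def smallJumpsBad (Z : ℕ → Ω → ℝ) (n : ℕ) (l δ ε : ℝ) : Set Ω :=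
  {ω | ∃ k ≤ n, ε * l < |∑ i ∈ Finset.range k, truncAt (δ * l) (Z i ω)|}

theorem abs_sum_truncAt_le_of_notMem {n : ℕ} {l δ ε : ℝ} (hl : 0 < l) {ω : Ω}
    (h : ω ∉ smallJumpsBad Z n l δ ε) :
    ∀ k ≤ n, |∑ i ∈ Finset.range k, truncAt δ (l⁻¹ * Z i ω)| ≤ ε := by
  intro k hk
  by_contra! hlt
  refine h ⟨k, hk, ?_⟩
  have hscale : ∀ i, truncAt δ (l⁻¹ * Z i ω) = l⁻¹ * truncAt (δ * l) (Z i ω) := by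
    intro i
    rw [mul_truncAt (inv_pos.mpr hl), mul_comm δ, inv_mul_cancel_left₀ hl.ne']
  simp only [hscale, ← Finset.mul_sum, abs_mul, abs_inv, abs_of_pos hl] at hlt
  rwa [inv_mul_eq_div, lt_div_iff₀ hl] at hlt

variable [MeasurableSpace Ω]

theorem measurable_walk (hmeas : ∀ i, Measurable (Z i)) (l : ℝ) (n : ℕ) :
    Measurable fun ω => l⁻¹ • walkPath Z n ω := by
  simp only [inv_smul_walkPath]
  exact (continuous_stepFun_left _).measurable.comp
    (measurable_pi_lambda _ fun i => (hmeas _).const_mul _)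

theorem measurableSet_range_eq_largeJumps (hmeas : ∀ i, Measurable (Z i)) (l δ : ℝ) {j n : ℕ}
    (k : Fin j → Fin n) :
    MeasurableSet {ω | Set.range k = largeJumps n δ fun i => l⁻¹ * Z i ω} := by
  have heq : {ω | Set.range k = largeJumps n δ fun i => l⁻¹ * Z i ω} =
      ⋂ i : Fin n, {ω | i ∈ Set.range k ↔ δ < |l⁻¹ * Z i ω|} := by
    ext ω
    simp only [Set.ext_iff, Finset.mem_coe, mem_largeJumps, Set.mem_iInter, Set.mem_ofPred_eq]
  rw [heq]
  refine MeasurableSet.iInter fun i => ?_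
  have hlt : MeasurableSet {ω | δ < |l⁻¹ * Z i ω|} :=
    measurableSet_lt measurable_const ((hmeas i).const_mul _).abs
  by_cases hi : i ∈ Set.range k
  · simpa only [hi, true_iff] using hlt
  · simpa only [hi, false_iff, Set.compl_ofPred] using hlt.compl

variable {P : Measure Ω}

theorem sum_measure_jumpsIn_inter_le (hmeas : ∀ i, Measurable (Z i)) {l : ℝ} (hl : 0 < l)
    {j n : ℕ} {G : Set SkorohodD} {ε c δ : ℝ} {B : Set ((Fin j → ℝ) × (Fin j → ℝ))}
    (hB : MeasurableSet B) (hBG : ∀ zu ∈ B, stepFun zu.1 zu.2 ∉ Metric.cthickening ε Gᶜ) :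
    ∑ k : Fin j → Fin n with StrictMono k, P (jumpsIn Z l c B k ∩
        {ω | Set.range k = largeJumps n δ fun i => l⁻¹ * Z i ω}) ≤
      P {ω | l⁻¹ • walkPath Z n ω ∈ G} + P (smallJumpsBad Z n l δ ε) := by
  rw [← measure_biUnion_finset]
  · refine (measure_mono fun ω hω => ?_).trans (measure_union_le _ _)
    obtain ⟨k, hk, ⟨-, hkB⟩, hrange⟩ := Set.mem_iUnion₂.mp hω
    by_cases hbad : ω ∈ smallJumpsBad Z n l δ ε
    · exact Or.inr hbad
    refine Or.inl ?_
    by_contra hG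
    rw [Set.mem_ofPred_eq, inv_smul_walkPath] at hG
    have hedist := edist_stepFun_comp_le (abs_sum_truncAt_le_of_notMem hl hbad)
      (Finset.mem_filter.mp hk).2.injective hrange
    exact hBG _ hkB (Metric.mem_cthickening_of_edist_le _ _ _ _ hG
      ((edist_comm _ _).trans_le hedist))
  · intro k hk k' hk' hne
    refine Set.disjoint_left.mpr fun ω hω hω' => hne ?_
    exact ((Finset.mem_filter.mp hk).2.range_inj (Finset.mem_filter.mp hk').2).mp
      (hω.2.trans hω'.2.symm)
  · exact fun k _ => (measurableSet_jumpsIn hmeas l c hB k).inter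
      (measurableSet_range_eq_largeJumps hmeas l δ k)

section Independence

variable [IsProbabilityMeasure P] (hmeas : ∀ i, Measurable (Z i)) (hindep : iIndepFun Z P)
  (hident : ∀ i, IdentDistrib (Z i) (Z 0) P P) {l : ℝ} (hl : 0 < l)

include hmeas hindep hident hl

theorem measure_subset_largeJumps (δ : ℝ) {n : ℕ} (S : Finset (Fin n)) :
    P {ω | S ⊆ largeJumps n δ fun i => l⁻¹ * Z i ω} =
      ENNReal.ofReal (absTail P (Z 0) (δ * l)) ^ S.card := by
  rw [← Finset.card_map Fin.valEmbedding, ← measure_forall_mem_absGt hmeas hindep hident hl]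
  congr 1
  ext ω
  simp [Finset.subset_iff, mem_largeJumps, mem_absGt]

theorem measure_le_card_largeJumps_le (δ : ℝ) (n m : ℕ) :
    P {ω | m ≤ (largeJumps n δ fun i => l⁻¹ * Z i ω).card} ≤
      ENNReal.ofReal (n * absTail P (Z 0) (δ * l)) ^ m := by
  set q := ENNReal.ofReal (absTail P (Z 0) (δ * l))
  calc _ ≤ P (⋃ S ∈ Finset.powersetCard m (Finset.univ : Finset (Fin n)),
        {ω | S ⊆ largeJumps n δ fun i => l⁻¹ * Z i ω}) := by
        refine measure_mono fun ω hω => ?_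
        obtain ⟨S, hS, hcard⟩ := Finset.exists_subset_card_eq hω
        exact Set.mem_biUnion (Finset.mem_coe.mpr
          (Finset.mem_powersetCard.mpr ⟨Finset.subset_univ _, hcard⟩)) hS
    _ ≤ ∑ S ∈ Finset.powersetCard m (Finset.univ : Finset (Fin n)),
        P {ω | S ⊆ largeJumps n δ fun i => l⁻¹ * Z i ω} := measure_biUnion_finset_le _ _
    _ = ∑ _ ∈ Finset.powersetCard m (Finset.univ : Finset (Fin n)), q ^ m :=
        Finset.sum_congr rfl fun S hS => by
          rw [measure_subset_largeJumps hmeas hindep hident hl, (Finset.mem_powersetCard.mp hS).2]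
    _ = (n.choose m : ℝ≥0∞) * q ^ m := by simp
    _ ≤ (n : ℝ≥0∞) ^ m * q ^ m := by
        gcongr
        exact_mod_cast Nat.choose_le_pow n m
    _ = _ := by rw [ENNReal.ofReal_mul n.cast_nonneg, ENNReal.ofReal_natCast, mul_pow]

theorem measure_walk_le {j n : ℕ} (hj : 1 ≤ j) {F : Set SkorohodD} {r ε c δ : ℝ} (hε : 0 ≤ ε)
    (hc : 0 ≤ c) (hr : c + ε < r) (hsep : IsSeparatedBy r (stepAtMost (j - 1)) F) :
    P {ω | l⁻¹ • walkPath Z n ω ∈ F} ≤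
      (∑ k : Fin j → Fin n with StrictMono k,
        P (jumpsIn Z l c (closure (jumpSet j c (Metric.cthickening ε F))) k)) +
      (P (smallJumpsBad Z n l δ ε) + ENNReal.ofReal (n * absTail P (Z 0) (δ * l)) ^ (j + 1)) := by
  set B := closure (jumpSet j c (Metric.cthickening ε F))
  set I : Ω → Finset (Fin n) := fun ω => largeJumps n δ fun i => l⁻¹ * Z i ω
  have hsub : {ω | l⁻¹ • walkPath Z n ω ∈ F} ⊆
      (⋃ k ∈ Finset.univ.filter fun k : Fin j → Fin n => StrictMono k, jumpsIn Z l c B k) ∪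
        (smallJumpsBad Z n l δ ε ∪ {ω | j + 1 ≤ (I ω).card}) := by
    intro ω hω
    rw [Set.mem_ofPred_eq, inv_smul_walkPath] at hω
    by_cases hbad : ω ∈ smallJumpsBad Z n l δ ε
    · exact Or.inr (Or.inl hbad)
    have hsum := abs_sum_truncAt_le_of_notMem hl hbad
    have hcard : j - 1 < (I ω).card := lt_card_largeJumps hsum hω hε hsep (by linarith)
    rcases (show j ≤ (I ω).card by omega).eq_or_lt' with heq | hgt
    · obtain ⟨k, hk, hmem⟩ := exists_mem_jumpSet hsum hω hε hsep hr heq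
      exact Or.inl (Set.mem_biUnion (Finset.mem_coe.mpr (Finset.mem_filter.mpr
        ⟨Finset.mem_univ k, hk⟩)) ⟨hmem.1, subset_closure hmem⟩)
    · exact Or.inr (Or.inr hgt)
  refine (measure_mono hsub).trans ((measure_union_le _ _).trans (add_le_add
    (measure_biUnion_finset_le _ _) ((measure_union_le _ _).trans (add_le_add le_rfl ?_))))
  exact measure_le_card_largeJumps_le hmeas hindep hident hl δ n (j + 1)

theorem measure_range_ssubset_largeJumps_le (δ : ℝ) {j n : ℕ} {k : Fin j → Fin n}
    (hk : Function.Injective k) :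
    P {ω | Set.range k ⊂ largeJumps n δ fun i => l⁻¹ * Z i ω} ≤
      n * ENNReal.ofReal (absTail P (Z 0) (δ * l)) ^ (j + 1) := by
  set q := ENNReal.ofReal (absTail P (Z 0) (δ * l))
  set K := Finset.univ.image k
  have hK : K.card = j := by
    rw [Finset.card_image_of_injective _ hk, Finset.card_univ, Fintype.card_fin]
  calc _ ≤ P (⋃ m ∈ Kᶜ, {ω | insert m K ⊆ largeJumps n δ fun i => l⁻¹ * Z i ω}) := by
        refine measure_mono fun ω hω => ?_
        obtain ⟨hsub, m, hm, hmk⟩ := Set.ssubset_iff_exists.mp hω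
        refine Set.mem_biUnion (x := m) (by simpa [K] using hmk) (Finset.insert_subset hm ?_)
        simpa [K, Finset.image_subset_iff, Set.range_subset_iff] using hsub
    _ ≤ ∑ m ∈ Kᶜ, P {ω | insert m K ⊆ largeJumps n δ fun i => l⁻¹ * Z i ω} :=
        measure_biUnion_finset_le _ _
    _ = ∑ _ ∈ Kᶜ, q ^ (j + 1) := Finset.sum_congr rfl fun m hm => by
        rw [measure_subset_largeJumps hmeas hindep hident hl,
          Finset.card_insert_of_notMem (Finset.mem_compl.mp hm), hK]
    _ ≤ ∑ _ : Fin n, q ^ (j + 1) := Finset.sum_le_sum_of_subset (Finset.subset_univ _)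
    _ = n * q ^ (j + 1) := by simp

theorem sum_measure_le_walk {j n : ℕ} {G : Set SkorohodD} {ε c δ : ℝ} (hδc : δ ≤ c)
    {B : Set ((Fin j → ℝ) × (Fin j → ℝ))} (hB : MeasurableSet B)
    (hBG : ∀ zu ∈ B, stepFun zu.1 zu.2 ∉ Metric.cthickening ε Gᶜ) :
    ∑ k : Fin j → Fin n with StrictMono k, P (jumpsIn Z l c B k) ≤
      P {ω | l⁻¹ • walkPath Z n ω ∈ G} +
      (P (smallJumpsBad Z n l δ ε) + ENNReal.ofReal (n * absTail P (Z 0) (δ * l)) ^ (j + 1)) := by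
  set q := ENNReal.ofReal (absTail P (Z 0) (δ * l))
  set K := Finset.univ.filter fun k : Fin j → Fin n => StrictMono k
  set E : (Fin j → Fin n) → Set Ω := fun k =>
    {ω | Set.range k = largeJumps n δ fun i => l⁻¹ * Z i ω}
  have hdiff : ∀ k ∈ K, P (jumpsIn Z l c B k \ E k) ≤ n * q ^ (j + 1) := by
    intro k hk
    refine (measure_mono fun ω hω => ?_).trans (measure_range_ssubset_largeJumps_le hmeas hindep
      hident hl δ (Finset.mem_filter.mp hk).2.injective)
    refine Set.ssubset_iff_subset_ne.mpr ⟨Set.range_subset_iff.mpr fun i => ?_, hω.2⟩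
    exact mem_largeJumps.mpr (hδc.trans_lt (mem_absGt.mp (hω.1.1 i)))
  have hcard : K.card ≤ n ^ j := (Finset.card_filter_le _ _).trans (by simp)
  calc ∑ k ∈ K, P (jumpsIn Z l c B k)
      ≤ ∑ k ∈ K, P (jumpsIn Z l c B k ∩ E k) + ∑ k ∈ K, P (jumpsIn Z l c B k \ E k) := by
        rw [← Finset.sum_add_distrib]
        exact Finset.sum_le_sum fun k _ => measure_le_inter_add_sdiff _ _ _
    _ ≤ (P {ω | l⁻¹ • walkPath Z n ω ∈ G} + P (smallJumpsBad Z n l δ ε)) +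
        K.card * (n * q ^ (j + 1)) := by
        rw [← nsmul_eq_mul]
        exact add_le_add (sum_measure_jumpsIn_inter_le hmeas hl hB hBG)
          (Finset.sum_le_card_nsmul _ _ _ hdiff)
    _ ≤ (P {ω | l⁻¹ • walkPath Z n ω ∈ G} + P (smallJumpsBad Z n l δ ε)) +
        (n : ℝ≥0∞) ^ j * (n * q ^ (j + 1)) := by
        gcongr
        exact_mod_cast hcard
    _ = _ := by
        rw [ENNReal.ofReal_mul n.cast_nonneg, ENNReal.ofReal_natCast, mul_pow, add_assoc,
          pow_succ (n : ℝ≥0∞), mul_assoc]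

end Independence

end Walk

/-! ### The limit theorem -/

section Limit

variable {α p c r : ℝ} {j : ℕ} {A : Set SkorohodD}

theorem mem_of_mem_closure_jumpSet (hc : 0 < c) (hA : IsClosed A)
    {zu : (Fin j → ℝ) × (Fin j → ℝ)} (h : zu ∈ closure (jumpSet j c A)) :
    (∀ i, zu.1 i ≠ 0) ∧ Monotone zu.2 ∧ (∀ i, zu.2 i ∈ Set.Icc (0 : ℝ) 1) ∧
      (zu ∈ interiorDomain j → stepFun zu.1 zu.2 ∈ A) := by
  have habs : ∀ i, c ≤ |zu.1 i| := fun i =>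
    closure_minimal (s := jumpSet j c A) (t := {zu | c ≤ |zu.1 i|})
      (fun zu hzu => (mem_absGt.mp (hzu.1 i)).le) (isClosed_le continuous_const (by fun_prop)) h
  have hmono : ∀ i k, i ≤ k → zu.2 i ≤ zu.2 k := fun i k hik =>
    closure_minimal (s := jumpSet j c A) (t := {zu | zu.2 i ≤ zu.2 k})
      (fun zu hzu => hzu.2.1.monotone hik) (isClosed_le (by fun_prop) (by fun_prop)) h
  have hIcc : ∀ i, zu.2 i ∈ Set.Icc (0 : ℝ) 1 := fun i =>
    closure_minimal (s := jumpSet j c A) (t := {zu | zu.2 i ∈ Set.Icc (0 : ℝ) 1})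
      (fun zu hzu => hzu.2.2.1 i) (isClosed_Icc.preimage (by fun_prop)) h
  refine ⟨fun i => abs_pos.mp (hc.trans_le (habs i)), fun i k => hmono i k, hIcc, fun hint => ?_⟩
  have hcont := (continuousOn_stepFun j).continuousAt ((isOpen_interiorDomain j).mem_nhds hint)
  have himage := mem_closure_image hcont h
  refine closure_minimal ?_ hA himage
  rintro _ ⟨zu', hzu', rfl⟩
  exact hzu'.2.2.2

/-- Interior jump data with all jumps larger than `c` that lead into `A`. -/
def interiorJumpSet (j : ℕ) (c : ℝ) (A : Set SkorohodD) : Set ((Fin j → ℝ) × (Fin j → ℝ)) :=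
  {zu | ∀ i, zu.1 i ∈ absGt c} ∩ (interiorDomain j ∩ (fun zu => stepFun zu.1 zu.2) ⁻¹' A)

theorem isOpen_interiorJumpSet (j : ℕ) (c : ℝ) (hA : IsOpen A) :
    IsOpen (interiorJumpSet j c A) := by
  refine IsOpen.inter ?_ ((continuousOn_stepFun j).isOpen_inter_preimage
    (isOpen_interiorDomain j) hA)
  have heq : {zu : (Fin j → ℝ) × (Fin j → ℝ) | ∀ i, zu.1 i ∈ absGt c} =
      ⋂ i, {zu | c < |zu.1 i|} := by
    ext zu
    simp [mem_absGt]
  rw [heq]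
  exact isOpen_iInter_of_finite fun i => isOpen_lt continuous_const (by fun_prop)

variable (hα : 0 < α) (hp0 : 0 ≤ p) (hp1 : p ≤ 1)

include hα hp0 hp1

theorem jumpLimit_le_one (hc : 0 < c) (B : Set ((Fin j → ℝ) × (Fin j → ℝ))) :
    jumpLimit α p c j B ≤ 1 := by
  have := isProbabilityMeasure_cond_nuAlpha hα hp0 hp1 hc
  have : IsProbabilityMeasure (volume.restrict (Set.Icc (0 : ℝ) 1)) := ⟨by simp⟩
  have : IsProbabilityMeasure (jumpLimit α p c j) := by unfold jumpLimit; infer_instance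
  exact prob_le_one

theorem mul_jumpLimit_apply (hc : 0 < c) (B : Set ((Fin j → ℝ) × (Fin j → ℝ))) :
    ENNReal.ofReal (c ^ (-α)) ^ j * jumpLimit α p c j B =
      ((Measure.pi fun _ : Fin j => nuAlpha α p).prod volume).restrict
        ((Set.univ.pi fun _ => absGt c) ×ˢ (Set.univ.pi fun _ => Set.Icc (0 : ℝ) 1)) B := by
  rw [← smul_jumpLimit hα hp0 hp1 hc, Measure.smul_apply, smul_eq_mul]

theorem mul_jumpLimit_closure_le (hc : 0 < c) (hA : IsClosed A) :
    ENNReal.ofReal (c ^ (-α)) ^ j * jumpLimit α p c j (closure (jumpSet j c A)) ≤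
      limitMeasure α p j A := by
  rw [mul_jumpLimit_apply hα hp0 hp1 hc, limitMeasure_apply hA.measurableSet]
  refine (Measure.restrict_apply_le _ _).trans (measure_mono_ae ?_)
  filter_upwards [ae_mem_interiorDomain (Measure.pi fun _ : Fin j => nuAlpha α p)] with zu hzu hmem
  obtain ⟨hne, hmono, hIcc, hstep⟩ := mem_of_mem_closure_jumpSet hc hA hmem
  exact ⟨⟨hne, hstep (hzu hmono hIcc)⟩, hzu hmono hIcc⟩

variable (hA : MeasurableSet A) (hsep : IsSeparatedBy r (stepAtMost (j - 1)) A)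

include hA hsep

theorem limitMeasure_le_mul_jumpLimit (hc : 0 < c) (hcr : c < r) :
    limitMeasure α p j A ≤
      ENNReal.ofReal (c ^ (-α)) ^ j * jumpLimit α p c j (interiorJumpSet j c A) := by
  have hprod : MeasurableSet ((Set.univ.pi fun _ : Fin j => absGt c) ×ˢ
      (Set.univ.pi fun _ : Fin j => Set.Icc (0 : ℝ) 1)) :=
    (MeasurableSet.univ_pi fun _ => measurableSet_absGt c).prod
      (MeasurableSet.univ_pi fun _ => measurableSet_Icc)
  rw [mul_jumpLimit_apply hα hp0 hp1 hc, limitMeasure_apply hA, Measure.restrict_apply' hprod]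
  refine measure_mono ?_
  rintro zu ⟨⟨-, hmem⟩, hint⟩
  have hIcc : ∀ i, zu.2 i ∈ Set.Icc (0 : ℝ) 1 := fun i => Set.Ioo_subset_Icc_self (hint.1 i)
  have habs : ∀ i, zu.1 i ∈ absGt c := fun i =>
    hcr.trans_le (le_abs_of_stepFun_mem hsep hint.2 hIcc hmem i)
  exact ⟨⟨habs, hint, hmem⟩, fun i _ => habs i, fun i _ => hIcc i⟩

theorem limitMeasure_lt_top (hr : 0 < r) : limitMeasure α p j A < ∞ := by
  have hhalf := half_pos hr
  refine (limitMeasure_le_mul_jumpLimit hα hp0 hp1 hA hsep hhalf (half_lt_self hr)).trans_lt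
    (ENNReal.mul_lt_top (ENNReal.pow_lt_top ENNReal.ofReal_lt_top) ?_)
  exact (jumpLimit_le_one hα hp0 hp1 hhalf _).trans_lt ENNReal.one_lt_top

end Limit

theorem finiteAwayFrom_limitMeasure {α p : ℝ} (hα : 0 < α) (hp0 : 0 ≤ p) (hp1 : p ≤ 1) (j : ℕ) :
    FiniteAwayFrom (stepAtMost (j - 1)) (limitMeasure α p j) := by
  intro A hA hsep
  obtain ⟨r, hr, hrA⟩ := exists_isSeparatedBy_of_areSeparated hsep
  exact limitMeasure_lt_top hα hp0 hp1 hA hrA hr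

section Convergence

variable {S : Type*} [PseudoEMetricSpace S]

theorem eq_iUnion_compl_cthickening_of_isOpen {G : Set S} (hG : IsOpen G) :
    G = ⋃ m : ℕ, (Metric.cthickening (1 / ((m : ℝ) + 1)) Gᶜ)ᶜ := by
  have hrange : ∀ ε > (0 : ℝ),
      (Set.range (fun m : ℕ => 1 / ((m : ℝ) + 1)) ∩ Set.Ioc 0 ε).Nonempty := by
    intro ε hε
    obtain ⟨m, hm⟩ := exists_nat_one_div_lt hε
    exact ⟨_, ⟨m, rfl⟩, by positivity, hm.le⟩
  have hclosure := Metric.closure_eq_iInter_cthickening' Gᶜ _ hrange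
  rw [hG.isClosed_compl.closure_eq, Set.biInter_range] at hclosure
  rw [← Set.compl_iInter, ← hclosure, compl_compl]

variable [MeasurableSpace S] [OpensMeasurableSpace S] {C : Set S} {μ : ℕ → Measure S}
  {μ₀ : Measure S}

theorem tendstoMO_of_cthickening (hfin : ∀ n, FiniteAwayFrom C (μ n))
    (hfin₀ : FiniteAwayFrom C μ₀)
    (hclosed : ∀ F : Set S, ∀ r > 0, IsClosed F → IsSeparatedBy r C F →
      ∀ᶠ ε in 𝓝[>] 0, limsup (fun n => μ n F) atTop ≤ μ₀ (Metric.cthickening ε F))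
    (hopen : ∀ G : Set S, ∀ r > 0, IsOpen G → IsSeparatedBy r C G →
      ∀ ε > 0, μ₀ (Metric.cthickening ε Gᶜ)ᶜ ≤ liminf (fun n => μ n G) atTop) :
    TendstoMO C μ μ₀ where
  finite := hfin
  finite_limit := hfin₀
  limsup_le F hF hsep := by
    obtain ⟨r, hr, hrF⟩ := exists_isSeparatedBy_of_areSeparated hsep
    have hhalf := half_pos hr
    have hthick : μ₀ (Metric.cthickening (r / 2) F) ≠ ∞ :=
      (hfin₀ _ Metric.isClosed_cthickening.measurableSet
        ((hrF.cthickening hhalf.le).areSeparated (sub_pos.mpr (half_lt_self hr)))).ne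
    exact ge_of_tendsto ((tendsto_measure_cthickening_of_isClosed ⟨_, hhalf, hthick⟩ hF).mono_left
      nhdsWithin_le_nhds) (hclosed F r hr hF hrF)
  le_liminf G hG hsep := by
    obtain ⟨r, hr, hrG⟩ := exists_isSeparatedBy_of_areSeparated hsep
    have hmono : Monotone fun m : ℕ => (Metric.cthickening (1 / ((m : ℝ) + 1)) Gᶜ)ᶜ :=
      fun m m' hmm => Set.compl_subset_compl.mpr
        (Metric.cthickening_mono (Nat.one_div_le_one_div hmm) _)
    calc μ₀ G = ⨆ m : ℕ, μ₀ (Metric.cthickening (1 / ((m : ℝ) + 1)) Gᶜ)ᶜ := by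
          rw [← hmono.measure_iUnion, ← eq_iUnion_compl_cthickening_of_isOpen hG]
      _ ≤ liminf (fun n => μ n G) atTop :=
          iSup_le fun m => hopen G r hr hG hrG _ (by positivity)

end Convergence

section Limsup

variable {ι : Type*} {l : Filter ι} [l.NeBot] {f u v e : ι → ℝ≥0∞} {a b : ℝ≥0∞}
  (hu : Tendsto u l (𝓝 a)) (he : Tendsto e l (𝓝 0))

include hu he

theorem limsup_le_mul_of_eventually_le (ha : a ≠ 0) (ha_top : a ≠ ∞)
    (hle : ∀ᶠ i in l, f i ≤ u i * v i + e i) (hv : limsup v l ≤ b) : limsup f l ≤ a * b :=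
  calc limsup f l ≤ limsup (u * v + e) l := limsup_le_limsup hle
    _ = limsup (u * v) l := ENNReal.limsup_add_of_right_tendsto_zero he _
    _ ≤ limsup u l * limsup v l := by
        rw [← hu.limsup_eq] at ha ha_top
        exact ENNReal.limsup_mul_le' (Or.inl ha) (Or.inl ha_top)
    _ ≤ a * b := mul_le_mul' hu.limsup_eq.le hv

theorem mul_le_liminf_of_eventually_le (hle : ∀ᶠ i in l, u i * v i ≤ f i + e i)
    (hv : b ≤ liminf v l) : a * b ≤ liminf f l :=
  calc a * b ≤ liminf u l * liminf v l := mul_le_mul' hu.liminf_eq.ge hv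
    _ ≤ liminf (u * v) l := ENNReal.le_liminf_mul
    _ ≤ liminf (f + e) l := liminf_le_liminf hle
    _ = liminf f l := ENNReal.liminf_add_of_right_tendsto_zero he _

end Limsup

section Normalization

variable {Ω : Type*} [MeasurableSpace Ω] {P : Measure Ω} [IsProbabilityMeasure P] {X : Ω → ℝ}
  {α : ℝ} {lam : ℕ → ℝ}

/-- The factor `[n * P(|X| > λ_n)]^(-j)` by which the laws of the walk are multiplied. -/
noncomputable def normalization (P : Measure Ω) (X : Ω → ℝ) (lam : ℕ → ℝ) (j n : ℕ) : ℝ≥0∞ :=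
  ENNReal.ofReal (((n : ℝ) * absTail P X (lam n))⁻¹ ^ j)

variable (hX : Measurable X) (hRV : RegVarRV P X α) (hltop : Tendsto lam atTop atTop)

include hX hRV hltop

theorem tendsto_normalization_mul (j : ℕ) {c : ℝ} (hc : 0 < c) :
    Tendsto (fun n : ℕ => normalization P X lam j n *
      ENNReal.ofReal (n * absTail P X (c * lam n)) ^ j) atTop
      (𝓝 (ENNReal.ofReal (c ^ (-α)) ^ j)) := by
  have hpos := hRV.absTail_pos hX
  have hlim := ENNReal.tendsto_ofReal (((hRV.tendsto_div hX hc).comp hltop).pow j)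
  rw [ENNReal.ofReal_pow (by positivity)] at hlim
  refine hlim.congr' ?_
  filter_upwards [eventually_ge_atTop 1] with n hn
  have : (0 : ℝ) < n := by exact_mod_cast hn
  have hT := hpos (lam n)
  have hTc := hpos (c * lam n)
  rw [normalization, ← ENNReal.ofReal_pow (by positivity), ← ENNReal.ofReal_mul (by positivity),
    ← mul_pow, Function.comp_apply]
  congr 2
  field_simp

theorem tendsto_normalization_error
    (hzero : Tendsto (fun n : ℕ => (n : ℝ) * absTail P X (lam n)) atTop (𝓝 0))
    {j : ℕ} {δ : ℝ} (hδ : 0 < δ) {E : ℕ → Set Ω}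
    (hE : Tendsto (fun n : ℕ => ((n : ℝ) * absTail P X (lam n))⁻¹ ^ j * P.real (E n))
      atTop (𝓝 0)) :
    Tendsto (fun n : ℕ => normalization P X lam j n *
      (P (E n) + ENNReal.ofReal (n * absTail P X (δ * lam n)) ^ (j + 1))) atTop (𝓝 0) := by
  have hpos := hRV.absTail_pos hX
  have hzero' : Tendsto (fun n : ℕ => (n : ℝ) * absTail P X (δ * lam n)) atTop (𝓝 0) := by
    have hlim := hzero.mul ((hRV.tendsto_div hX hδ).comp hltop)
    rw [zero_mul] at hlim
    refine hlim.congr fun n => ?_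
    have := (hpos (lam n)).ne'
    rw [Function.comp_apply]
    field_simp
  have hmany := ENNReal.Tendsto.mul (tendsto_normalization_mul hX hRV hltop j hδ)
    (Or.inr (by simp)) (ENNReal.tendsto_ofReal hzero')
    (Or.inr (ENNReal.pow_ne_top ENNReal.ofReal_ne_top))
  have hlim := (ENNReal.tendsto_ofReal hE).add hmany
  rw [ENNReal.ofReal_zero, mul_zero, add_zero] at hlim
  refine hlim.congr fun n => ?_
  have hT := hpos (lam n)
  rw [mul_add, pow_succ, ← mul_assoc, ENNReal.ofReal_mul (by positivity), ofReal_measureReal,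
    normalization]

end Normalization

section Walk

variable {Ω : Type*} [MeasurableSpace Ω] {P : Measure Ω} [IsProbabilityMeasure P]
  {Z : ℕ → Ω → ℝ} {α p : ℝ} {lam : ℕ → ℝ} {j : ℕ} {r ε c δ : ℝ} {F G : Set SkorohodD}
  (hmeas : ∀ i, Measurable (Z i)) (hindep : iIndepFun Z P)
  (hident : ∀ i, IdentDistrib (Z i) (Z 0) P P) (hα : 0 < α) (hRV : RegVarRV P (Z 0) α)
  (hbal : TailBalance P (Z 0) p) (hlpos : ∀ n, 1 ≤ n → 0 < lam n)
  (hltop : Tendsto lam atTop atTop)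
  (hzero : Tendsto (fun n : ℕ => (n : ℝ) * absTail P (Z 0) (lam n)) atTop (𝓝 0))

include hmeas hindep hident hα hRV hbal hlpos hltop hzero

section Bounds

variable (hc : 0 < c) (hδ : 0 < δ)
  (hsmall : Tendsto (fun n : ℕ => ((n : ℝ) * absTail P (Z 0) (lam n))⁻¹ ^ j *
    P.real (smallJumpsBad Z n (lam n) δ ε)) atTop (𝓝 0))

include hc hδ hsmall

theorem limsup_walk_le (hj : 1 ≤ j) (hε : 0 ≤ ε) (hr : c + ε < r)
    (hsep : IsSeparatedBy r (stepAtMost (j - 1)) F) :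
    limsup (fun n => normalization P (Z 0) lam j n *
      P {ω | (lam n)⁻¹ • walkPath Z n ω ∈ F}) atTop ≤
      limitMeasure α p j (Metric.cthickening ε F) := by
  have hp0 := hbal.1
  have hp1 := hbal.2.1
  have hcα : 0 < c ^ (-α) := by positivity
  set B := closure (jumpSet j c (Metric.cthickening ε F))
  refine le_trans ?_ (mul_jumpLimit_closure_le hα hp0 hp1 hc Metric.isClosed_cthickening)
  refine limsup_le_mul_of_eventually_le (tendsto_normalization_mul (hmeas 0) hRV hltop j hc)
    (tendsto_normalization_error (hmeas 0) hRV hltop hzero hδ hsmall)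
    (pow_ne_zero _ (by simpa using hcα)) (ENNReal.pow_ne_top ENNReal.ofReal_ne_top) ?_
    (limsup_jumpMeasure_le (hmeas 0) hRV hα hbal hc hlpos hltop isClosed_closure)
  filter_upwards [eventually_ge_atTop 1] with n hn
  rw [mul_assoc, ← mul_add]
  gcongr
  refine (measure_walk_le (δ := δ) hmeas hindep hident (hlpos n hn) hj hε hc.le hr hsep).trans ?_
  gcongr
  exact sum_measure_jumpsAt_le hmeas hindep hident hRV (hlpos n hn) c hn
    isClosed_closure.measurableSet

theorem le_liminf_walk (hδc : δ ≤ c) (hcr : c < r) (hsep : IsSeparatedBy r (stepAtMost (j - 1)) G) :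
    limitMeasure α p j (Metric.cthickening ε Gᶜ)ᶜ ≤
      liminf (fun n => normalization P (Z 0) lam j n *
        P {ω | (lam n)⁻¹ • walkPath Z n ω ∈ G}) atTop := by
  have hp0 := hbal.1
  have hp1 := hbal.2.1
  set A := (Metric.cthickening ε Gᶜ)ᶜ
  have hA : IsOpen A := Metric.isClosed_cthickening.isOpen_compl
  have hAG : A ⊆ G := Set.compl_subset_comm.mp (Metric.self_subset_cthickening _)
  set B := interiorJumpSet j c A
  have hB : IsOpen B := isOpen_interiorJumpSet j c hA
  refine (limitMeasure_le_mul_jumpLimit hα hp0 hp1 hA.measurableSet (hsep.mono_right hAG) hc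
    hcr).trans ?_
  refine mul_le_liminf_of_eventually_le (tendsto_normalization_mul (hmeas 0) hRV hltop j hc)
    (tendsto_normalization_error (hmeas 0) hRV hltop hzero hδ hsmall) ?_
    (le_liminf_jumpMeasure (hmeas 0) hRV hα hbal hc hlpos hltop hB)
  filter_upwards [eventually_ge_atTop 1] with n hn
  rw [mul_assoc, ← mul_add]
  gcongr
  refine le_trans ?_ (sum_measure_le_walk hmeas hindep hident (hlpos n hn) hδc
    hB.measurableSet fun _ hzu => hzu.2.2)
  exact le_sum_measure_jumpsAt hmeas hindep hident hRV (hlpos n hn) c hn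
    hB.measurableSet fun _ hzu => hzu.2.1.2

end Bounds

theorem tendstoMO_walk_of_small_jumps (hj : 1 ≤ j)
    (hsmall : ∀ ε c : ℝ, 0 < ε → 0 < c → ∃ δ, 0 < δ ∧ δ ≤ c ∧
      Tendsto (fun n : ℕ => ((n : ℝ) * absTail P (Z 0) (lam n))⁻¹ ^ j *
        P.real (smallJumpsBad Z n (lam n) δ ε)) atTop (𝓝 0)) :
    TendstoMO (stepAtMost (j - 1))
      (fun n => normalization P (Z 0) lam j n • P.map fun ω => (lam n)⁻¹ • walkPath Z n ω)
      (limitMeasure α p j) := by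
  have hmap : ∀ (n : ℕ) {A : Set SkorohodD}, MeasurableSet A →
      (normalization P (Z 0) lam j n • P.map fun ω => (lam n)⁻¹ • walkPath Z n ω) A =
        normalization P (Z 0) lam j n * P {ω | (lam n)⁻¹ • walkPath Z n ω ∈ A} := by
    intro n A hA
    rw [Measure.smul_apply, Measure.map_apply (measurable_walk hmeas _ _) hA]
    rfl
  refine tendstoMO_of_cthickening (fun n A hA _ => ?_)
    (finiteAwayFrom_limitMeasure hα hbal.1 hbal.2.1 j) (fun F r hr hF hsep => ?_)
    fun G r hr hG hsep ε hε => ?_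
  · rw [hmap n hA]
    exact ENNReal.mul_lt_top ENNReal.ofReal_lt_top (measure_lt_top _ _)
  · have hhalf := half_pos hr
    simp only [hmap _ hF.measurableSet]
    filter_upwards [Ioo_mem_nhdsGT hhalf] with ε hε
    obtain ⟨δ, hδ, -, hsmall⟩ := hsmall ε (r / 2) hε.1 hhalf
    exact limsup_walk_le hmeas hindep hident hα hRV hbal hlpos hltop hzero hhalf hδ hsmall hj
      hε.1.le (by linarith [hε.2]) hsep
  · have hhalf := half_pos hr
    simp only [hmap _ hG.measurableSet]
    obtain ⟨δ, hδ, hδr, hsmall⟩ := hsmall ε (r / 2) hε hhalf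
    exact le_liminf_walk hmeas hindep hident hα hRV hbal hlpos hltop hzero hhalf hδ hsmall hδr
      (half_lt_self hr) hsep

end Walk

theorem theorem3p5 {Ω : Type*} [MeasurableSpace Ω] (P : Measure Ω) [IsProbabilityMeasure P]
    (Z : ℕ → Ω → ℝ) (hmeas : ∀ i, Measurable (Z i)) (hindep : iIndepFun Z P)
    (hident : ∀ i, IdentDistrib (Z i) (Z 0) P P)
    (α p ρ : ℝ) (hα : 0 < α)
    (hRV : RegVarRV P (Z 0) α) (hbal : TailBalance P (Z 0) p)
    (hmean : Integrable (Z 0) P → ∫ ω, Z 0 ω ∂P = 0)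
    (lam : ℕ → ℝ) (hlam : RegVarSeq lam ρ) (hlam_top : Tendsto lam atTop atTop)
    (hfin : evariance (Z 0) P < ∞ → 1 / 2 < ρ)
    (hinf : evariance (Z 0) P = ∞ → 1 < α * ρ)
    (j : ℕ) (hj : 1 ≤ j) :
    TendstoMO (stepAtMost (j - 1))
      (fun n => ENNReal.ofReal (((n : ℝ) * P.real {ω | lam n < |Z 0 ω|})⁻¹ ^ j) •
        P.map (fun ω => (lam n)⁻¹ • walkPath Z n ω))
      (limitMeasure α p j) :=
  tendstoMO_walk_of_small_jumps hmeas hindep hident hα hRV hbal hlam.1 hlam_top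
    (hRV.tendsto_mul_absTail_zero (hmeas 0) hα hfin hinf hlam) hj fun _ _ hε hc =>
      exists_tendsto_small_jumps hmeas hindep hident hα hRV hmean hlam hlam_top hfin hinf j hε hc
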